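/- There is a universal constant $C<\infty$ such that the following holds. Let $F$ be a discrete distribution on $[0,1]$ with atoms $0\le a_1<\dots<a_m\le 1$ of masses $f_1,\dots,f_m>0$, $\sum_i f_i=1$, and let $\varepsilon_0=\min_i f_i$. Then for all $T\in\mathbb N$ and all $B\in\{1,\dots,T\}$, the CwG policy is a feasible online policy and $$\mathrm{Regret}(B,T)\;\le\;\mathrm{Regret}(B,T;\mathrm{CwG})\;\le\; C\,\frac{\sqrt{\log(1/\varepsilon_0)}}{\varepsilon_0}.$$ Here the setting is the multi-secretary problem. The abilities $\theta_1,\dots,\theta_T$ are i.i.d. with law $F$, and $U_1,\dots,U_T$ are i.i.d. uniform on $[0,1]$ and independent of the abilities. A feasible online policy $\pi\in\Pi(B,T)$ is a sequence of $\{0,1\}$-valued random variables $\mu_1,\dots,\mu_T$, with $\mu_t$ measurable with respect to $\sigma(\theta_1,U_1,\dots,\theta_t,U_t)$ and $\sum_t\mu_t\le B$ almost surely ($\mu_t=1$ means that candidate $t$ is hired). Put $$\mathrm{Regret}(B,T;\pi)=\mathbb E\Big[\max\Big\{\sum_{t\in S}\theta_t: S\subseteq\{1,\dots,T\},\ |S|\le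 B\Big\}\Big]-\mathbb E\Big[\sum_{t=1}^T\theta_t\mu_t\Big],\qquad \mathrm{Regret}(B,T)=\inf_{\pi\in\Pi(B,T)}\mathrm{Regret}(B,T;\pi).$$ The CwG (conservative with respect to gaps) policy is defined as follows. Let $F^{-1}(q)=\inf\{v\in[0,1]:F(v)\ge q\}$, let $q_i^\star=F(a_i)$ for $1\le i\le m-1$ be the gap quantiles, let $B_0=B$, let $B_t$ be the budget left after period $t$, and let $\tilde T=\max\{0,\,T-\lfloor 16\log(1/\varepsilon_0)/\varepsilon_0^2\rfloor\}$. In each period $t$, let $X_t$ be uniformly distributed on the interval $\{q\in[0,1]:F^{-1}(q)=\theta_t\}$ given $\theta_t$, the randomization being supplied by $U_t$. Candidate $t$ is hired if and only if $B_{t-1}>0$ and $X_t\ge p_{t-1}$, where the threshold $p_{t-1}$ is given by: * for $t\le\tilde T$, put $n=T-t+1$ and $p^{\mathrm{ce}}_{t-1}=1-B_{t-1}/n$. If no gap quantile is at distance less than $\sqrt{2\log n/n}$ from $p^{\mathrm{ce}}_{t-1}$, then $p_{t-1}=p^{\mathrm{ce}}_{t-1}$. Otherwise $p_{t-1}$ is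 a gap quantile nearest to $p^{\mathrm{ce}}_{t-1}$, ties being broken by an arbitrary fixed rule depending on $n$ and $B_{t-1}$; * for $t>\tilde T$, $p_{t-1}=1-B_{\tilde T}/(T-\tilde T)$. -/

import Mathlib

open MeasureTheory ProbabilityTheory

noncomputable section

namespace MultiSecretary

/-- The discrete law with an atom of mass `f i` at each point `a i`. -/
def discreteLaw {m : ℕ} (a f : Fin m → ℝ) : Measure ℝ :=
  ∑ i, ENNReal.ofReal (f i) • Measure.dirac (a i)

/-- The abilities `θ t` are i.i.d. with law `law`, the auxiliary variables `U t` are i.i.d.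
uniform on `[0, 1]`, and the whole family (all abilities and all auxiliary variables together)
is mutually independent.  Time is indexed by `Fin T`; the index `t` is the period `t + 1`. -/
structure IsSampling {Ω : Type*} [MeasurableSpace Ω] (P : Measure Ω) (law : Measure ℝ) {T : ℕ}
    (θ U : Fin T → Ω → ℝ) : Prop where
  measurable_ability : ∀ t, Measurable (θ t)
  measurable_aux : ∀ t, Measurable (U t)
  law_ability : ∀ t, P.map (θ t) = law
  law_aux : ∀ t, P.map (U t) = volume.restrict (Set.Icc (0 : ℝ) 1)
  indep : iIndepFun (Sum.elim θ U) P

/-- The σ-algebra generated by the abilities and auxiliary variables up to and including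
period `t`. -/
@[reducible] def history {Ω : Type*} {T : ℕ} (θ U : Fin T → Ω → ℝ) (t : Fin T) : MeasurableSpace Ω :=
  ⨆ s : Fin T, ⨆ _ : s ≤ t,
    MeasurableSpace.comap (θ s) inferInstance ⊔ MeasurableSpace.comap (U s) inferInstance

/-- The feasible online policies with budget `B`: the `t`-th binary decision (`true` is "hire")
is measurable with respect to the history up to `t`, and almost surely at most `B` candidates
are hired. -/
def feasiblePolicies {Ω : Type*} [MeasurableSpace Ω] (P : Measure Ω) {T : ℕ}
    (θ U : Fin T → Ω → ℝ) (B : ℕ) : Set (Fin T → Ω → Bool) :=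
  {μ | (∀ t, Measurable[history θ U t] (μ t)) ∧
    ∀ᵐ ω ∂P, (Finset.univ.filter fun t => μ t ω = true).card ≤ B}

/-- The expected total ability of the candidates hired by `μ`. -/
def onlineValue {Ω : Type*} [MeasurableSpace Ω] (P : Measure Ω) {T : ℕ}
    (θ : Fin T → Ω → ℝ) (μ : Fin T → Ω → Bool) : ℝ :=
  ∫ ω, ∑ t, (if μ t ω = true then θ t ω else 0) ∂P

/-- The largest total ability of a set of at most `B` candidates, for known abilities `x`. -/
def hindsightValue {T : ℕ} (B : ℕ) (x : Fin T → ℝ) : ℝ :=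
  (Finset.univ.filter fun S : Finset (Fin T) => S.card ≤ B).sup'
    ⟨∅, by simp⟩ (fun S => ∑ t ∈ S, x t)

/-- The expected value of the offline (full information) problem. -/
def offlineValue {Ω : Type*} [MeasurableSpace Ω] (P : Measure Ω) {T : ℕ}
    (θ : Fin T → Ω → ℝ) (B : ℕ) : ℝ :=
  ∫ ω, hindsightValue B (fun t => θ t ω) ∂P

/-- The expected regret of the policy `μ`. -/
def regret {Ω : Type*} [MeasurableSpace Ω] (P : Measure Ω) {T : ℕ}
    (θ : Fin T → Ω → ℝ) (B : ℕ) (μ : Fin T → Ω → Bool) : ℝ :=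
  offlineValue P θ B - onlineValue P θ μ

/-- The minimum achievable expected regret: the infimum over all feasible online policies. -/
def optimalRegret {Ω : Type*} [MeasurableSpace Ω] (P : Measure Ω) {T : ℕ}
    (θ U : Fin T → Ω → ℝ) (B : ℕ) : ℝ :=
  ⨅ μ : feasiblePolicies P θ U B, regret P θ B μ.1

/-- The quantile function `F⁻¹(q) = inf {v : F v ≥ q}` of a distribution function `F` of a law
on `[0, 1]`. -/
def quantile (F : ℝ → ℝ) (q : ℝ) : ℝ :=
  sInf {v : ℝ | v ∈ Set.Icc (0 : ℝ) 1 ∧ q ≤ F v}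

/-- The set of quantiles `q ∈ [0, 1]` with `F⁻¹(q) = x`; it is an interval (or empty). -/
def quantileSet (F : ℝ → ℝ) (x : ℝ) : Set ℝ :=
  {q : ℝ | q ∈ Set.Icc (0 : ℝ) 1 ∧ quantile F q = x}

/-- A point of the interval `quantileSet F x`, uniformly distributed on it when `u` is uniform
on `[0, 1]`. -/
def quantileSample (F : ℝ → ℝ) (x u : ℝ) : ℝ :=
  sInf (quantileSet F x) + u * (sSup (quantileSet F x) - sInf (quantileSet F x))

/-- The gap quantiles `F (a i)`, one for each gap `(a i, a (i + 1))` between consecutive atoms. -/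
def gapQuantiles {m : ℕ} (F : ℝ → ℝ) (a : Fin m → ℝ) : Set ℝ :=
  {q : ℝ | ∃ i : Fin m, (i : ℕ) + 1 < m ∧ q = F (a i)}

/-- The certainty equivalent threshold when the remaining budget is `b` and `n` periods remain. -/
def ceThreshold (b n : ℕ) : ℝ := 1 - (b : ℝ) / (n : ℝ)

/-- The gap quantiles in `Q` that are within the confidence radius `√(2 log n / n)` of the
certainty equivalent threshold. -/
def closeGaps (Q : Set ℝ) (b n : ℕ) : Set ℝ :=
  {q : ℝ | q ∈ Q ∧ ceThreshold b n ∈ Metric.ball q (Real.sqrt (2 * Real.log n / n))}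

/-- `p` is a "conservative with respect to gaps" threshold rule: `p n b`, the threshold used when
`n` periods remain and the remaining budget is `b`, is the certainty equivalent threshold if no
gap quantile is close to it, and otherwise a close gap quantile that is nearest to it. Ties
between two nearest gap quantiles may be broken in any way. -/
def IsCwGThreshold (Q : Set ℝ) (p : ℕ → ℕ → ℝ) : Prop :=
  ∀ n b : ℕ, 1 ≤ n →
    (closeGaps Q b n = ∅ → p n b = ceThreshold b n) ∧
    ((closeGaps Q b n).Nonempty → p n b ∈ closeGaps Q b n ∧
      ∀ q ∈ closeGaps Q b n, |ceThreshold b n - p n b| ≤ |ceThreshold b n - q|)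

/-- The remaining budget after `t` periods when, in each period `s` (counted from `0`), the
candidate with sampled quantile `X s` is hired if and only if budget is left and `X s` is at
least the threshold `thr s b`, where `b` is the current remaining budget. -/
def budgetAfter {T : ℕ} (thr : ℕ → ℕ → ℝ) (B : ℕ) (X : Fin T → ℝ) : ℕ → ℕ
  | 0 => B
  | t + 1 =>
    open Classical in
    if ∃ h : t < T, thr t (budgetAfter thr B X t) ≤ X ⟨t, h⟩ ∧ 0 < budgetAfter thr B X t then
      budgetAfter thr B X t - 1
    else budgetAfter thr B X t

/-- The length of the first phase of the policy. -/
def phaseOneLength (ε₀ : ℝ) (T : ℕ) : ℕ :=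
  T - ⌊16 * Real.log (1 / ε₀) / ε₀ ^ 2⌋₊

/-- The thresholds used by the CwG policy on a path `X` of sampled quantiles: in the first phase
those of the rule `p`; in the second phase the certainty equivalent threshold computed once, from
the budget left at the end of the first phase. -/
def cwgThresholds {T : ℕ} (ε₀ : ℝ) (p : ℕ → ℕ → ℝ) (B : ℕ) (X : Fin T → ℝ) : ℕ → ℕ → ℝ :=
  fun t b =>
    if t < phaseOneLength ε₀ T then p (T - t) b
    else ceThreshold (budgetAfter (fun s c => p (T - s) c) B X (phaseOneLength ε₀ T))
      (T - phaseOneLength ε₀ T)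

/-- The decision of the CwG policy in period `t` on a path `X` of sampled quantiles. -/
def cwgDecision {T : ℕ} (ε₀ : ℝ) (p : ℕ → ℕ → ℝ) (B : ℕ) (X : Fin T → ℝ) (t : Fin T) : Bool :=
  open Classical in
  decide (cwgThresholds ε₀ p B X t (budgetAfter (cwgThresholds ε₀ p B X) B X t) ≤ X t ∧
    0 < budgetAfter (cwgThresholds ε₀ p B X) B X t)

/-- The CwG policy for the distribution function `F`, with threshold rule `p`. -/
def cwgPolicy {Ω : Type*} {T : ℕ} (F : ℝ → ℝ) (ε₀ : ℝ) (p : ℕ → ℕ → ℝ) (B : ℕ)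
    (θ U : Fin T → Ω → ℝ) : Fin T → Ω → Bool :=
  fun t ω => cwgDecision ε₀ p B (fun s => quantileSample F (θ s ω) (U s ω)) t

end MultiSecretary

end

noncomputable section

namespace MultiSecretary

/-! The regret is bounded path by path. Replacing one offline decision at a time by that of the
policy (`offlineFrom_univ_le`) costs at most 1 per period. A hire is free if fewer than `b` later
candidates are strictly better, and a rejection is free if at least `b` later candidates are as
good, where `b` is the current budget.

With `n` periods left, the conservative threshold makes costly decisions rare. If it lies on the
wrong side of a gap quantile `q` for the decision to be safe, then the certainty equivalent
threshold lies on that same side of `q`, at distance at least δ, the minimum of the confidence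
radius and half the smallest mass. A decision can then cost something only if the number of later
candidates above some gap deviates from its mean by `n` δ (`card_better_lt_of_hire`,
`le_card_of_reject`). By Hoeffding and a union bound over the `m - 1` gaps this has probability at
most `(m - 1) * 64 / n ^ 2` throughout the first phase, which sums to at most `(m - 1) * 128`.

In the second phase the threshold is constant. The loss is at most the mismatch between the number
of candidates above it and the number that can be hired (`offlineFrom_le_of_const`). The sampled
quantiles are uniform, so given the budget this mismatch is a centred sum, with mean absolute value
at most half the square root of the phase length. Finally `m ≤ 1 / ε₀`, and the phase length is at
most `16 log (1 / ε₀) / ε₀ ^ 2`, so both terms are of the claimed order. -/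

/-- The largest total value of a set of at most `b` candidates from `A`. -/
def offlineFrom {ι : Type*} (v : ι → ℝ) (A : Finset ι) (b : ℕ) : ℝ :=
  (A.powerset.filter fun S : Finset ι => S.card ≤ b).sup' ⟨∅, by simp⟩ (fun S => ∑ t ∈ S, v t)

/-! ### Exchange arguments for the offline problem -/

section Offline

variable {ι : Type*} {v : ι → ℝ} {A : Finset ι} {b : ℕ}

theorem offlineFrom_le {c : ℝ} (h : ∀ S ⊆ A, S.card ≤ b → ∑ t ∈ S, v t ≤ c) :
    offlineFrom v A b ≤ c := by
  apply Finset.sup'_le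
  intro S hS
  simp only [Finset.mem_filter, Finset.mem_powerset] at hS
  exact h S hS.1 hS.2

theorem le_offlineFrom {S : Finset ι} (h : S ⊆ A) (hb : S.card ≤ b) :
    ∑ t ∈ S, v t ≤ offlineFrom v A b :=
  Finset.le_sup' (f := fun S : Finset ι => ∑ t ∈ S, v t)
    (by simpa only [Finset.mem_filter, Finset.mem_powerset] using ⟨h, hb⟩)

theorem hindsightValue_eq_offlineFrom {T : ℕ} (B : ℕ) (x : Fin T → ℝ) :
    hindsightValue B x = offlineFrom x Finset.univ B := by
  simp [hindsightValue, offlineFrom]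

variable [DecidableEq ι]

/-- Hiring `x` is optimal when fewer than `b` later candidates are strictly better. -/
theorem offlineFrom_insert_le_of_hire {x : ι} (h0 : 0 ≤ v x)
    (h : (A.filter fun s => v x < v s).card < b) :
    offlineFrom v (insert x A) b ≤ v x + offlineFrom v A (b - 1) := by
  apply offlineFrom_le
  intro S hS hc
  by_cases hx : x ∈ S
  · rw [← Finset.add_sum_erase _ _ hx]
    gcongr
    apply le_offlineFrom
    · rwa [← Finset.subset_insert_iff]
    · rw [Finset.card_erase_of_mem hx]; omega
  · have hSA : S ⊆ A := (Finset.subset_insert_iff_of_notMem hx).1 hS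
    rcases hc.lt_or_eq with hc | hc
    · have : ∑ t ∈ S, v t ≤ offlineFrom v A (b - 1) := le_offlineFrom hSA (by omega)
      linarith
    · obtain ⟨y, hy, hyx⟩ : ∃ y ∈ S, v y ≤ v x := by
        by_contra! hcon
        have : S ⊆ A.filter fun s => v x < v s := fun s hs =>
          Finset.mem_filter.2 ⟨hSA hs, hcon s hs⟩
        have := Finset.card_le_card this
        omega
      rw [← Finset.add_sum_erase _ _ hy]
      gcongr
      apply le_offlineFrom
      · exact (Finset.erase_subset _ _).trans hSA
      · rw [Finset.card_erase_of_mem hy]; omega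

/-- Rejecting `x` is optimal when at least `b` later candidates are as good. -/
theorem offlineFrom_insert_le_of_reject {x : ι} (h : b ≤ (A.filter fun s => v x ≤ v s).card) :
    offlineFrom v (insert x A) b ≤ offlineFrom v A b := by
  apply offlineFrom_le
  intro S hS hc
  by_cases hx : x ∈ S
  -- The rest of the selection is too small to contain all candidates as good as `x`, so an unused
  -- one can take the place of `x`.
  · have hcard : (S.erase x).card < (A.filter fun s => v x ≤ v s).card := by
      have := Finset.card_pos.2 ⟨x, hx⟩
      rw [Finset.card_erase_of_mem hx]; omega
    obtain ⟨y, hy, hyS⟩ := Finset.exists_mem_notMem_of_card_lt_card hcard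
    rw [Finset.mem_filter] at hy
    rw [← Finset.add_sum_erase _ _ hx]
    calc v x + ∑ t ∈ S.erase x, v t ≤ v y + ∑ t ∈ S.erase x, v t := by gcongr; exact hy.2
      _ = ∑ t ∈ insert y (S.erase x), v t := (Finset.sum_insert hyS).symm
      _ ≤ _ := by
        apply le_offlineFrom
        · exact Finset.insert_subset hy.1 (by rwa [← Finset.subset_insert_iff])
        · rw [Finset.card_insert_of_notMem hyS, Finset.card_erase_of_mem hx]
          have := Finset.card_pos.2 ⟨x, hx⟩
          omega
  · exact le_offlineFrom ((Finset.subset_insert_iff_of_notMem hx).1 hS) hc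

/-- Dropping any one member of an optimal selection frees a slot for `x`, and that member is worth
at most 1. -/
theorem offlineFrom_insert_le_hire_add_one {x : ι} (h0 : 0 ≤ v x) (h1 : ∀ s, v s ≤ 1) :
    offlineFrom v (insert x A) b ≤ v x + offlineFrom v A (b - 1) + 1 := by
  apply offlineFrom_le
  intro S hS hc
  by_cases hx : x ∈ S
  · rw [← Finset.add_sum_erase _ _ hx]
    have : ∑ t ∈ S.erase x, v t ≤ offlineFrom v A (b - 1) :=
      le_offlineFrom (by rwa [← Finset.subset_insert_iff])
        (by rw [Finset.card_erase_of_mem hx]; omega)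
    linarith
  · have hSA : S ⊆ A := (Finset.subset_insert_iff_of_notMem hx).1 hS
    rcases S.eq_empty_or_nonempty with rfl | ⟨y, hy⟩
    · have : ∑ t ∈ (∅ : Finset ι), v t ≤ offlineFrom v A (b - 1) :=
        le_offlineFrom (Finset.empty_subset _) (by simp)
      linarith
    · rw [← Finset.add_sum_erase _ _ hy]
      have : ∑ t ∈ S.erase y, v t ≤ offlineFrom v A (b - 1) :=
        le_offlineFrom ((Finset.erase_subset _ _).trans hSA)
          (by rw [Finset.card_erase_of_mem hy]; omega)
      linarith [h1 y]

theorem offlineFrom_insert_le_reject_add_one {x : ι} (h1 : ∀ s, v s ≤ 1) :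
    offlineFrom v (insert x A) b ≤ offlineFrom v A b + 1 := by
  apply offlineFrom_le
  intro S hS hc
  by_cases hx : x ∈ S
  · rw [← Finset.add_sum_erase _ _ hx]
    have : ∑ t ∈ S.erase x, v t ≤ offlineFrom v A b :=
      le_offlineFrom (by rwa [← Finset.subset_insert_iff])
        ((Finset.card_le_card (Finset.erase_subset _ _)).trans hc)
    linarith [h1 x]
  · have := le_offlineFrom (v := v) ((Finset.subset_insert_iff_of_notMem hx).1 hS) hc
    linarith

/-- The loss of hiring `min b |G|` candidates from an upper set `G`. -/
theorem offlineFrom_le_sum_add_abs (h0 : ∀ s, 0 ≤ v s) (h1 : ∀ s, v s ≤ 1) {G H : Finset ι}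
    (hGA : G ⊆ A) (hHG : H ⊆ G) (hH : H.card = min b G.card)
    (hG : ∀ s ∈ G, ∀ r ∈ A, r ∉ G → v r ≤ v s) :
    offlineFrom v A b ≤ ∑ t ∈ H, v t + |(G.card : ℝ) - (min b A.card : ℕ)| := by
  -- The level `c` acts as the price of a slot: after subtracting it, members of `G` have
  -- nonnegative value and all others nonpositive value, so no selection beats `G` in net value.
  obtain ⟨c, hc0, hc1, hcG, hcA⟩ : ∃ c : ℝ, 0 ≤ c ∧ c ≤ 1 ∧ (∀ s ∈ G, c ≤ v s) ∧
      ∀ r ∈ A, r ∉ G → v r ≤ c := by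
    rcases G.eq_empty_or_nonempty with rfl | hne
    · exact ⟨1, by simp, le_rfl, by simp, fun r _ _ => h1 r⟩
    · obtain ⟨g, hg, hmin⟩ := G.exists_min_image v hne
      exact ⟨v g, h0 g, h1 g, hmin, hG g hg⟩
  apply offlineFrom_le
  intro S hS hc
  have hk : (S.card : ℝ) ≤ (min b A.card : ℕ) := by
    exact_mod_cast le_min hc (Finset.card_le_card hS)
  have e1 : ∑ t ∈ S, v t = ∑ t ∈ S, (v t - c) + c * S.card := by
    rw [Finset.sum_sub_distrib, Finset.sum_const, nsmul_eq_mul]; ring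
  have e2 : ∑ t ∈ H, v t = ∑ t ∈ H, (v t - c) + c * H.card := by
    rw [Finset.sum_sub_distrib, Finset.sum_const, nsmul_eq_mul]; ring
  have e3 : ∑ t ∈ S, (v t - c) ≤ ∑ t ∈ G, (v t - c) := by
    calc ∑ t ∈ S, (v t - c) = ∑ t ∈ S ∩ G, (v t - c) + ∑ t ∈ S \ G, (v t - c) :=
          (Finset.sum_inter_add_sum_sdiff S G _).symm
      _ ≤ ∑ t ∈ S ∩ G, (v t - c) + 0 := by
          gcongr
          apply Finset.sum_nonpos
          intro t ht
          rw [Finset.mem_sdiff] at ht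
          linarith [hcA t (hS ht.1) ht.2]
      _ ≤ ∑ t ∈ G, (v t - c) := by
          rw [add_zero]
          apply Finset.sum_le_sum_of_subset_of_nonneg Finset.inter_subset_right
          intro t ht _
          linarith [hcG t ht]
  have e4 : ∑ t ∈ G, (v t - c) = ∑ t ∈ H, (v t - c) + ∑ t ∈ G \ H, (v t - c) := by
    rw [add_comm]; exact (Finset.sum_sdiff hHG).symm
  have e5 : ∑ t ∈ G \ H, (v t - c) ≤ (1 - c) * ((G.card : ℝ) - H.card) := by
    calc ∑ t ∈ G \ H, (v t - c) ≤ ∑ t ∈ G \ H, (1 - c) := by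
          gcongr with t _; exact h1 t
      _ = _ := by
          rw [Finset.sum_const, nsmul_eq_mul, Finset.card_sdiff_of_subset hHG,
            Nat.cast_sub (Finset.card_le_card hHG)]; ring
  have hGA' := Finset.card_le_card hGA
  have e6 : c * S.card ≤ c * (min b A.card : ℕ) := by gcongr
  -- If `G` is too large, each unhired member costs at most `1 - c`; if it is too small, each unused
  -- slot costs at most `c`.
  rcases le_total b G.card with hb | hb
  · rw [min_eq_left hb] at hH
    rw [min_eq_left (hb.trans hGA')] at e6 ⊢
    have hb' : (b : ℝ) ≤ G.card := by exact_mod_cast hb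
    rw [abs_of_nonneg (by linarith)]
    rw [hH] at e2 e5
    nlinarith
  · rw [min_eq_right hb] at hH
    have hkG : (G.card : ℝ) ≤ (min b A.card : ℕ) := by exact_mod_cast le_min hb hGA'
    rw [abs_of_nonpos (by linarith)]
    rw [hH] at e2 e5
    nlinarith

end Offline

/-! ### The budget process and the decomposition of the loss by periods -/

/-- The candidate of period `t` is hired by the threshold policy `thr`. -/
def IsHired {T : ℕ} (thr : ℕ → ℕ → ℝ) (B : ℕ) (X : Fin T → ℝ) (t : Fin T) : Prop :=
  thr t (budgetAfter thr B X t) ≤ X t ∧ 0 < budgetAfter thr B X t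

section Budget

variable {T : ℕ} {thr : ℕ → ℕ → ℝ} {B : ℕ} {X : Fin T → ℝ}

theorem budgetAfter_succ_of_isHired {t : Fin T} (h : IsHired thr B X t) :
    budgetAfter thr B X (t + 1) = budgetAfter thr B X t - 1 := by
  rw [budgetAfter, if_pos ⟨t.2, h⟩]

theorem budgetAfter_succ_of_not_isHired {t : Fin T} (h : ¬ IsHired thr B X t) :
    budgetAfter thr B X (t + 1) = budgetAfter thr B X t := by
  rw [budgetAfter, if_neg (fun ⟨_, h'⟩ => h h')]

/-- Only earlier thresholds influence the current budget. Hence the budget entering the second phase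
is the one computed from the first-phase rule alone. -/
theorem budgetAfter_congr {thr' : ℕ → ℕ → ℝ} {t : ℕ} (h : ∀ s < t, ∀ b, thr s b = thr' s b) :
    budgetAfter thr B X t = budgetAfter thr' B X t := by
  induction t with
  | zero => rfl
  | succ t ih =>
    simp only [budgetAfter, ih fun s hs => h s (by omega), h t (by omega)]

theorem filter_le_eq_insert (t : Fin T) :
    (Finset.univ.filter fun s : Fin T => (t : ℕ) ≤ s) =
      insert t (Finset.univ.filter fun s : Fin T => (t : ℕ) + 1 ≤ s) := by
  ext s
  simp only [Finset.mem_filter, Finset.mem_univ, true_and, Finset.mem_insert, Fin.ext_iff]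
  omega

theorem sum_window_succ {M : Type*} [AddCommMonoid M] (g : Fin T → M) {l : ℕ} {t : Fin T}
    (hl : l ≤ t) :
    ∑ s ∈ Finset.univ.filter (fun s : Fin T => l ≤ (s : ℕ) ∧ (s : ℕ) < (t : ℕ) + 1), g s =
      g t + ∑ s ∈ Finset.univ.filter (fun s : Fin T => l ≤ (s : ℕ) ∧ (s : ℕ) < (t : ℕ)), g s := by
  rw [← Finset.sum_insert (by simp)]
  congr 1
  ext s
  simp only [Finset.mem_filter, Finset.mem_univ, true_and, Finset.mem_insert, Fin.ext_iff]
  omega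

theorem sum_window_self {M : Type*} [AddCommMonoid M] (g : Fin T → M) (l : ℕ) :
    ∑ s ∈ Finset.univ.filter (fun s : Fin T => l ≤ (s : ℕ) ∧ (s : ℕ) < l), g s = 0 := by
  rw [Finset.filter_false_of_mem (by intros; omega), Finset.sum_empty]

open Classical in
theorem sum_hired_add_budgetAfter {l k : ℕ} (hlk : l ≤ k) (hk : k ≤ T) :
    ∑ s ∈ Finset.univ.filter (fun s : Fin T => l ≤ (s : ℕ) ∧ (s : ℕ) < k), (if IsHired thr B X s then 1 else 0) +
      budgetAfter thr B X k = budgetAfter thr B X l := by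
  induction k, hlk using Nat.le_induction with
  | base => rw [sum_window_self, zero_add]
  | succ k hlk ih =>
    have ih := ih (by omega)
    have e := sum_window_succ (fun s => if IsHired thr B X s then 1 else 0)
      (t := (⟨k, hk⟩ : Fin T)) hlk
    dsimp only at e
    rw [e]
    by_cases h : IsHired thr B X ⟨k, hk⟩
    · have := budgetAfter_succ_of_isHired h
      have h2 := h.2
      dsimp only at this h2
      rw [if_pos h, this]
      omega
    · have := budgetAfter_succ_of_not_isHired h
      dsimp only at this
      rw [if_neg h, this]
      omega

open Classical in
-- Truncated subtraction is exactly right here: once the budget is exhausted, further candidates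
-- above the threshold change nothing.
theorem budgetAfter_of_const {l k : ℕ} {q : ℝ} (hq : ∀ t b, l ≤ t → thr t b = q)
    (hlk : l ≤ k) (hk : k ≤ T) :
    budgetAfter thr B X k = budgetAfter thr B X l -
      ∑ s ∈ Finset.univ.filter (fun s : Fin T => l ≤ (s : ℕ) ∧ (s : ℕ) < k), (if q ≤ X s then 1 else 0) := by
  induction k, hlk using Nat.le_induction with
  | base => rw [sum_window_self, Nat.sub_zero]
  | succ k hlk ih =>
    have ih := ih (by omega)
    have e := sum_window_succ (fun s => if q ≤ X s then 1 else 0)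
      (t := (⟨k, hk⟩ : Fin T)) hlk
    dsimp only at e
    rw [e]
    by_cases h : IsHired thr B X ⟨k, hk⟩
    · have := budgetAfter_succ_of_isHired h
      have h1 := h.1
      dsimp only at this h1
      rw [hq _ _ hlk] at h1
      rw [if_pos h1, this]
      omega
    · have := budgetAfter_succ_of_not_isHired h
      dsimp only at this
      rw [this]
      by_cases h1 : q ≤ X ⟨k, hk⟩
      · have h2 : ¬ 0 < budgetAfter thr B X k := fun h2 => h ⟨by rwa [hq _ _ hlk], h2⟩
        rw [if_pos h1]
        omega
      · rw [if_neg h1]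
        omega

open Classical in
theorem card_isHired_le : (Finset.univ.filter fun t => IsHired thr B X t).card ≤ B := by
  have := sum_hired_add_budgetAfter (thr := thr) (B := B) (X := X) (Nat.zero_le T) le_rfl
  simp only [Nat.zero_le, Fin.is_lt, and_self, Finset.filter_true] at this
  rw [Finset.sum_boole] at this
  simp only [budgetAfter, Nat.cast_id] at this
  omega

open Classical in
/-- With a constant threshold from period `l` on, the loss from then on is at most the difference
between the number of candidates above the threshold and the number that can be hired. -/
theorem offlineFrom_le_of_const {v : Fin T → ℝ} (h0 : ∀ s, 0 ≤ v s) (h1 : ∀ s, v s ≤ 1)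
    (hv : ∀ s r, X r < X s → v r ≤ v s)
    {l : ℕ} {q : ℝ} (hq : ∀ t b, l ≤ t → thr t b = q) (hl : l ≤ T) :
    offlineFrom v (Finset.univ.filter fun s : Fin T => l ≤ (s : ℕ)) (budgetAfter thr B X l) ≤
      ∑ s ∈ Finset.univ.filter (fun s : Fin T => l ≤ (s : ℕ)), (if IsHired thr B X s then v s else 0) +
      |((∑ s ∈ Finset.univ.filter (fun s : Fin T => l ≤ (s : ℕ)), if q ≤ X s then 1 else 0 : ℕ) : ℝ) -
        (min (budgetAfter thr B X l) (T - l) : ℕ)| := by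
  have e1 := sum_hired_add_budgetAfter (thr := thr) (B := B) (X := X) hl le_rfl
  have e2 := budgetAfter_of_const (B := B) (X := X) hq hl le_rfl
  simp only [Fin.is_lt, and_true] at e1 e2
  have hcard : (Finset.univ.filter fun s : Fin T => l ≤ (s : ℕ)).card = T - l := by
    have h := Fin.card_filter_val_lt (n := T) (m := l)
    have h2 := Finset.card_filter_add_card_filter_not (s := (Finset.univ : Finset (Fin T)))
      (fun s => (s : ℕ) < l)
    simp only [not_lt, Finset.card_univ, Fintype.card_fin] at h2
    omega
  have key := offlineFrom_le_sum_add_abs h0 h1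
    (A := Finset.univ.filter fun s : Fin T => l ≤ (s : ℕ)) (b := budgetAfter thr B X l)
    (G := (Finset.univ.filter fun s : Fin T => l ≤ (s : ℕ)).filter fun s => q ≤ X s)
    (H := (Finset.univ.filter fun s : Fin T => l ≤ (s : ℕ)).filter fun s => IsHired thr B X s)
    (Finset.filter_subset _ _) ?_ ?_ ?_
  · rw [hcard, Finset.sum_filter (IsHired thr B X)] at key
    rwa [Finset.sum_boole, Nat.cast_id]
  · intro s hs
    rw [Finset.mem_filter] at hs ⊢
    refine ⟨hs.1, ?_⟩
    have := hs.2.1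
    rwa [hq _ _ (by simpa using hs.1)] at this
  -- The two expressions for the final budget force the number of hires to be the minimum of the
  -- budget and the number above the threshold.
  · rw [Finset.sum_boole, Nat.cast_id] at e1 e2
    omega
  · intro s hs r hr hrG
    rw [Finset.mem_filter] at hs hrG
    apply hv
    have : X r < q := by by_contra! h; exact hrG ⟨hr, h⟩
    linarith [hs.2]

open Classical in
/-- The loss of a threshold policy accumulates the losses of the single periods. -/
theorem offlineFrom_univ_le {v : Fin T → ℝ} {e : Fin T → ℝ} {k : ℕ} (hk : k ≤ T)
    (hhire : ∀ t : Fin T, (t : ℕ) < k → IsHired thr B X t →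
      offlineFrom v (insert t (Finset.univ.filter fun s : Fin T => (t : ℕ) + 1 ≤ s))
          (budgetAfter thr B X t) ≤
        v t + offlineFrom v (Finset.univ.filter fun s : Fin T => (t : ℕ) + 1 ≤ s)
          (budgetAfter thr B X t - 1) + e t)
    (hreject : ∀ t : Fin T, (t : ℕ) < k → ¬ IsHired thr B X t →
      offlineFrom v (insert t (Finset.univ.filter fun s : Fin T => (t : ℕ) + 1 ≤ s))
          (budgetAfter thr B X t) ≤
        offlineFrom v (Finset.univ.filter fun s : Fin T => (t : ℕ) + 1 ≤ s)
          (budgetAfter thr B X t) + e t) :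
    offlineFrom v Finset.univ B ≤
      ∑ s ∈ Finset.univ.filter (fun s : Fin T => (s : ℕ) < k), (if IsHired thr B X s then v s else 0) +
      ∑ s ∈ Finset.univ.filter (fun s : Fin T => (s : ℕ) < k), e s +
      offlineFrom v (Finset.univ.filter fun s : Fin T => k ≤ (s : ℕ)) (budgetAfter thr B X k) := by
  induction k with
  | zero => simp [budgetAfter]
  | succ k ih =>
    have ih := ih (by omega) (fun t ht => hhire t (by omega)) (fun t ht => hreject t (by omega))
    have e1 := sum_window_succ (fun s => if IsHired thr B X s then v s else 0)
      (t := (⟨k, hk⟩ : Fin T)) (Nat.zero_le _)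
    have e2 := sum_window_succ e (t := (⟨k, hk⟩ : Fin T)) (Nat.zero_le _)
    have e3 := filter_le_eq_insert (⟨k, hk⟩ : Fin T)
    simp only [Nat.zero_le, true_and] at e1 e2 e3
    rw [e1, e2]
    rw [e3] at ih
    by_cases h : IsHired thr B X ⟨k, hk⟩
    · have h1 := budgetAfter_succ_of_isHired h
      have h2 := hhire ⟨k, hk⟩ (by simp) h
      dsimp only at h1 h2
      rw [h1, if_pos h]
      linarith
    · have h1 := budgetAfter_succ_of_not_isHired h
      have h2 := hreject ⟨k, hk⟩ (by simp) h
      dsimp only at h1 h2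
      rw [h1, if_neg h]
      linarith

end Budget


/-! ### Quantiles of a discrete law -/

/-- The total mass of the first `k` atoms. -/
def cumMass {m : ℕ} (f : Fin m → ℝ) (k : ℕ) : ℝ :=
  ∑ i ∈ Finset.univ.filter (fun i : Fin m => (i : ℕ) < k), f i

section CumMass

variable {m : ℕ} {a f : Fin m → ℝ}

theorem cumMass_zero : cumMass f 0 = 0 := by simp [cumMass]

theorem cumMass_top : cumMass f m = ∑ i, f i := by simp [cumMass]

theorem cumMass_succ (j : Fin m) : cumMass f (j + 1) = cumMass f j + f j := by
  have := sum_window_succ f (t := j) (Nat.zero_le _)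
  simp only [Nat.zero_le, true_and] at this
  rw [cumMass, this, cumMass, add_comm]

theorem cumMass_mono (hf : ∀ i, 0 < f i) : Monotone (cumMass f) := by
  intro k l h
  apply Finset.sum_le_sum_of_subset_of_nonneg
  · intro i
    simp only [Finset.mem_filter, Finset.mem_univ, true_and]
    omega
  · intro i _ _
    exact (hf i).le

theorem exists_mem_Ioc_cumMass (hs : ∑ i, f i = 1) {q : ℝ} (hq : q ∈ Set.Ioc (0 : ℝ) 1) :
    ∃ j : Fin m, q ∈ Set.Ioc (cumMass f j) (cumMass f (j + 1)) := by
  classical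
  have hex : ∃ k, q ≤ cumMass f k := ⟨m, by rw [cumMass_top, hs]; exact hq.2⟩
  have h0 : Nat.find hex ≠ 0 := by
    intro h
    have := Nat.find_spec hex
    rw [h, cumMass_zero] at this
    linarith [hq.1]
  have hm : Nat.find hex ≤ m := Nat.find_min' hex (by rw [cumMass_top, hs]; exact hq.2)
  refine ⟨⟨Nat.find hex - 1, by omega⟩, ?_, ?_⟩
  · have := Nat.find_min hex (m := Nat.find hex - 1) (by omega)
    exact not_le.1 this
  · have := Nat.find_spec hex
    rwa [← Nat.sub_add_cancel (Nat.one_le_iff_ne_zero.2 h0)] at this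

/-- Applied with `g x = max x q`, it adds up over the atoms the probability that the sampled
quantile is at least `q`. -/
theorem sum_telescope_cumMass (hs : ∑ i, f i = 1) (g : ℝ → ℝ) :
    ∑ j : Fin m, (g (cumMass f (j + 1)) - g (cumMass f j)) = g 1 - g 0 := by
  rw [Fin.sum_univ_eq_sum_range (fun k => g (cumMass f (k + 1)) - g (cumMass f k)) m,
    Finset.sum_range_sub (fun k => g (cumMass f k)), cumMass_top, hs, cumMass_zero]

theorem isProbabilityMeasure_discreteLaw (hf : ∀ i, 0 < f i) (hs : ∑ i, f i = 1) :
    IsProbabilityMeasure (discreteLaw a f) := by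
  constructor
  simp only [discreteLaw, Measure.coe_finsetSum, Finset.sum_apply, Measure.smul_apply,
    measure_univ, smul_eq_mul, mul_one]
  rw [← ENNReal.ofReal_sum_of_nonneg fun i _ => (hf i).le, hs, ENNReal.ofReal_one]

open Classical in
theorem discreteLaw_real_apply (hf : ∀ i, 0 < f i) {s : Set ℝ} (hms : MeasurableSet s) :
    (discreteLaw a f).real s = ∑ i ∈ Finset.univ.filter (fun i => a i ∈ s), f i := by
  rw [Measure.real, discreteLaw, Measure.coe_finsetSum, Finset.sum_apply, Finset.sum_filter,
    ENNReal.toReal_sum]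
  · apply Finset.sum_congr rfl
    intro i _
    by_cases h : a i ∈ s
    · simp [hms, h, (hf i).le]
    · simp [hms, h]
  · intro i _
    by_cases h : a i ∈ s <;> simp [hms, h]

theorem cdf_discreteLaw (ha : StrictMono a) (hf : ∀ i, 0 < f i) (hs : ∑ i, f i = 1)
    (j : Fin m) : cdf (discreteLaw a f) (a j) = cumMass f (j + 1) := by
  have := isProbabilityMeasure_discreteLaw (a := a) hf hs
  rw [cdf_eq_real, discreteLaw_real_apply hf measurableSet_Iic, cumMass]
  congr 1
  ext i
  simp only [Set.mem_Iic, ha.le_iff_le, Finset.mem_filter, Finset.mem_univ, true_and,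
    Fin.le_def, Nat.lt_succ_iff]

theorem cdf_discreteLaw_le_of_lt (ha : StrictMono a) (hf : ∀ i, 0 < f i) (hs : ∑ i, f i = 1)
    {j : Fin m} {v : ℝ} (hv : v < a j) : cdf (discreteLaw a f) v ≤ cumMass f j := by
  have := isProbabilityMeasure_discreteLaw (a := a) hf hs
  rw [cdf_eq_real, discreteLaw_real_apply hf measurableSet_Iic, cumMass]
  apply Finset.sum_le_sum_of_subset_of_nonneg
  · intro i
    simp only [Set.mem_Iic, Finset.mem_filter, Finset.mem_univ, true_and]
    intro h
    exact ha.lt_iff_lt.1 (h.trans_lt hv)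
  · intro i _ _
    exact (hf i).le

theorem quantile_zero : quantile (cdf (discreteLaw a f)) 0 = 0 := by
  have : {v : ℝ | v ∈ Set.Icc (0 : ℝ) 1 ∧ 0 ≤ cdf (discreteLaw a f) v} = Set.Icc 0 1 := by
    ext v
    simp [cdf_nonneg]
  rw [quantile, this, csInf_Icc zero_le_one]

variable (ha : StrictMono a) (ha01 : ∀ i, a i ∈ Set.Icc (0 : ℝ) 1) (hf : ∀ i, 0 < f i)
  (hs : ∑ i, f i = 1)

include ha ha01 hf hs

theorem quantile_eq {j : Fin m} {q : ℝ} (hq : q ∈ Set.Ioc (cumMass f j) (cumMass f (j + 1))) :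
    quantile (cdf (discreteLaw a f)) q = a j := by
  have : {v : ℝ | v ∈ Set.Icc (0 : ℝ) 1 ∧ q ≤ cdf (discreteLaw a f) v} = Set.Icc (a j) 1 := by
    ext v
    simp only [Set.mem_ofPred_eq, Set.mem_Icc]
    constructor
    · rintro ⟨⟨h0, h1⟩, h⟩
      refine ⟨?_, h1⟩
      by_contra! hv
      linarith [cdf_discreteLaw_le_of_lt ha hf hs hv, hq.1]
    · rintro ⟨h0, h1⟩
      refine ⟨⟨(ha01 j).1.trans h0, h1⟩, hq.2.trans ?_⟩
      rw [← cdf_discreteLaw ha hf hs]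
      exact monotone_cdf _ h0
  rw [quantile, this, csInf_Icc (ha01 j).2]

/-- The quantile at 0 is 0 by definition, so the left endpoint 0 belongs to the set of the first
atom only when that atom is 0. Enclosing the set between `Ioc` and `Icc` avoids the distinction,
since both have the same infimum and supremum. -/
theorem quantileSet_subset (j : Fin m) :
    quantileSet (cdf (discreteLaw a f)) (a j) ⊆ Set.Icc (cumMass f j) (cumMass f (j + 1)) := by
  rintro q ⟨hq, h⟩
  have hpos : ∀ k, 0 ≤ cumMass f k := fun k => by
    rw [← cumMass_zero (f := f)]; exact cumMass_mono hf (Nat.zero_le k)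
  rcases hq.1.eq_or_lt with rfl | hq0
  · rw [quantile_zero] at h
    have hj : (j : ℕ) = 0 := by
      by_contra hj
      have : a ⟨0, by omega⟩ < a j := ha (Fin.lt_def.2 (Nat.pos_of_ne_zero hj))
      linarith [(ha01 ⟨0, by omega⟩).1]
    exact ⟨by rw [hj, cumMass_zero], hpos _⟩
  · obtain ⟨k, hk⟩ := exists_mem_Ioc_cumMass hs ⟨hq0, hq.2⟩
    rw [quantile_eq ha ha01 hf hs hk] at h
    rw [← ha.injective h]
    exact Set.Ioc_subset_Icc_self hk

theorem subset_quantileSet (j : Fin m) :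
    Set.Ioc (cumMass f j) (cumMass f (j + 1)) ⊆ quantileSet (cdf (discreteLaw a f)) (a j) := by
  intro q hq
  refine ⟨⟨?_, ?_⟩, quantile_eq ha ha01 hf hs hq⟩
  · refine le_trans ?_ hq.1.le
    rw [← cumMass_zero (f := f)]
    exact cumMass_mono hf (Nat.zero_le _)
  · refine hq.2.trans ?_
    rw [← hs, ← cumMass_top]
    exact cumMass_mono hf j.2

theorem quantileSample_eq (j : Fin m) (u : ℝ) :
    quantileSample (cdf (discreteLaw a f)) (a j) u = cumMass f j + u * f j := by
  have hlt : cumMass f j < cumMass f (j + 1) := by rw [cumMass_succ]; linarith [hf j]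
  have h1 := quantileSet_subset ha ha01 hf hs j
  have h2 := subset_quantileSet ha ha01 hf hs j
  have hne : (Set.Ioc (cumMass f j) (cumMass f (j + 1))).Nonempty := Set.nonempty_Ioc.2 hlt
  have hinf : sInf (quantileSet (cdf (discreteLaw a f)) (a j)) = cumMass f j := by
    apply le_antisymm
    · rw [← csInf_Ioc hlt]
      exact csInf_le_csInf (bddBelow_Icc.mono h1) hne h2
    · rw [← csInf_Icc hlt.le]
      exact csInf_le_csInf bddBelow_Icc (hne.mono h2) h1
  have hsup : sSup (quantileSet (cdf (discreteLaw a f)) (a j)) = cumMass f (j + 1) := by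
    apply le_antisymm
    · rw [← csSup_Icc hlt.le]
      exact csSup_le_csSup bddAbove_Icc (hne.mono h2) h1
    · rw [← csSup_Ioc hlt]
      exact csSup_le_csSup (bddAbove_Icc.mono h1) hne h2
  rw [quantileSample, hinf, hsup, cumMass_succ]
  ring

theorem quantileSet_subset_zero {x : ℝ} (hx : x ∉ Set.range a) :
    quantileSet (cdf (discreteLaw a f)) x ⊆ {0} := by
  rintro q ⟨hq, h⟩
  rcases hq.1.eq_or_lt with rfl | hq0
  · rfl
  · obtain ⟨k, hk⟩ := exists_mem_Ioc_cumMass hs ⟨hq0, hq.2⟩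
    rw [quantile_eq ha ha01 hf hs hk] at h
    exact absurd ⟨k, h⟩ hx

/-- Off the atoms the quantile set is empty or `{0}`, and `sInf` and `sSup` are 0 in both cases.
Such values form a null set, but they must be known for a measurable formula valid everywhere. -/
theorem quantileSample_eq_zero {x : ℝ} (hx : x ∉ Set.range a) (u : ℝ) :
    quantileSample (cdf (discreteLaw a f)) x u = 0 := by
  rcases Set.subset_singleton_iff_eq.1 (quantileSet_subset_zero ha ha01 hf hs hx) with h | h <;>
  simp [quantileSample, h]

open Classical in
theorem measurable_quantileSample :
    Measurable fun z : ℝ × ℝ => quantileSample (cdf (discreteLaw a f)) z.1 z.2 := by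
  have : (fun z : ℝ × ℝ => quantileSample (cdf (discreteLaw a f)) z.1 z.2) =
      fun z => ∑ j, (if z.1 = a j then cumMass f j + z.2 * f j else 0) := by
    ext ⟨x, u⟩
    by_cases hx : x ∈ Set.range a
    · obtain ⟨j, rfl⟩ := hx
      simp only [quantileSample_eq ha ha01 hf hs, ha.injective.eq_iff]
      simp
    · rw [quantileSample_eq_zero ha ha01 hf hs hx, Finset.sum_eq_zero]
      intro j _
      rw [if_neg]
      rintro rfl
      exact hx ⟨j, rfl⟩
  rw [this]
  refine Finset.measurable_sum _ fun j _ => ?_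
  refine Measurable.ite (measurable_fst (measurableSet_singleton _)) ?_ measurable_const
  fun_prop

end CumMass


/-! ### Position of the conservative threshold relative to gap quantiles -/

section Threshold

variable {Q : Set ℝ} {p : ℕ → ℕ → ℝ} {ε : ℝ} {n b : ℕ} {q : ℝ}

/-- If some gap is close, the chosen one is nearest among the close gaps and within the radius,
hence also at least as near as every gap that is not close. -/
theorem IsCwGThreshold.eq_or_mem (hp : IsCwGThreshold Q p) (hn : 1 ≤ n) (hq : q ∈ Q) :
    (p n b = ceThreshold b n ∧ Real.sqrt (2 * Real.log n / n) ≤ |ceThreshold b n - q|) ∨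
      (p n b ∈ Q ∧ |ceThreshold b n - p n b| ≤ |ceThreshold b n - q|) := by
  obtain ⟨h1, h2⟩ := hp n b hn
  have far : q ∉ closeGaps Q b n → Real.sqrt (2 * Real.log n / n) ≤ |ceThreshold b n - q| := by
    intro h
    by_contra! hlt
    exact h ⟨hq, by rwa [Metric.mem_ball, Real.dist_eq]⟩
  rcases (closeGaps Q b n).eq_empty_or_nonempty with he | hne
  · exact Or.inl ⟨h1 he, far (by simp [he])⟩
  · obtain ⟨hmem, hmin⟩ := h2 hne
    refine Or.inr ⟨hmem.1, ?_⟩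
    by_cases hqc : q ∈ closeGaps Q b n
    · exact hmin q hqc
    · have := hmem.2
      rw [Metric.mem_ball, Real.dist_eq] at this
      exact this.le.trans (far hqc)

/-- Either the threshold is the certainty equivalent one, which is then a full radius from `q`, or
it is a gap quantile at least `ε` below `q` and no farther from the certainty equivalent threshold.
In the latter case that threshold lies below the midpoint, so at least `ε / 2` below `q`. -/
theorem IsCwGThreshold.ceThreshold_add_le (hp : IsCwGThreshold Q p)
    (hsep : ∀ q ∈ Q, ∀ q' ∈ Q, q < q' → q + ε ≤ q') (hn : 1 ≤ n) (hq : q ∈ Q) (h : p n b < q) :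
    ceThreshold b n + min (Real.sqrt (2 * Real.log n / n)) (ε / 2) ≤ q := by
  rcases hp.eq_or_mem (b := b) hn hq with ⟨h1, h2⟩ | ⟨h1, h2⟩
  · rw [abs_of_neg (by linarith)] at h2
    linarith [min_le_left (Real.sqrt (2 * Real.log n / n)) (ε / 2)]
  · have h3 := hsep _ h1 _ hq h
    have h4 := min_le_right (Real.sqrt (2 * Real.log n / n)) (ε / 2)
    rcases abs_cases (ceThreshold b n - p n b) with ⟨h5, _⟩ | ⟨h5, _⟩ <;>
    rcases abs_cases (ceThreshold b n - q) with ⟨h6, _⟩ | ⟨h6, _⟩ <;> linarith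

theorem IsCwGThreshold.add_le_ceThreshold (hp : IsCwGThreshold Q p)
    (hsep : ∀ q ∈ Q, ∀ q' ∈ Q, q < q' → q + ε ≤ q') (hn : 1 ≤ n) (hq : q ∈ Q) (h : q < p n b) :
    q + min (Real.sqrt (2 * Real.log n / n)) (ε / 2) ≤ ceThreshold b n := by
  rcases hp.eq_or_mem (b := b) hn hq with ⟨h1, h2⟩ | ⟨h1, h2⟩
  · rw [abs_of_pos (by linarith)] at h2
    linarith [min_le_left (Real.sqrt (2 * Real.log n / n)) (ε / 2)]
  · have h3 := hsep _ hq _ h1 h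
    have h4 := min_le_right (Real.sqrt (2 * Real.log n / n)) (ε / 2)
    rcases abs_cases (ceThreshold b n - p n b) with ⟨h5, _⟩ | ⟨h5, _⟩ <;>
    rcases abs_cases (ceThreshold b n - q) with ⟨h6, _⟩ | ⟨h6, _⟩ <;> linarith

/-- With budget for everybody the certainty equivalent threshold is at most 0, and no gap is close
enough to pull it up. -/
theorem IsCwGThreshold.nonpos (hp : IsCwGThreshold Q p)
    (hQ : ∀ q ∈ Q, Real.sqrt (2 * Real.log n / n) ≤ q) (hn : 1 ≤ n) (hb : n ≤ b) :
    p n b ≤ 0 := by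
  have hn' : (0 : ℝ) < n := by exact_mod_cast hn
  have hce : ceThreshold b n ≤ 0 := by
    rw [ceThreshold, sub_nonpos, one_le_div hn']
    exact_mod_cast hb
  have : closeGaps Q b n = ∅ := by
    rw [Set.eq_empty_iff_forall_notMem]
    rintro q ⟨hq, hball⟩
    rw [Metric.mem_ball, Real.dist_eq, abs_lt] at hball
    linarith [hQ q hq]
  rwa [(hp n b hn).1 this]

end Threshold

theorem card_mul_minMass_le_one {m : ℕ} {f : Fin m → ℝ} {ε₀ : ℝ} (hs : ∑ i, f i = 1)
    (hε : IsLeast (Set.range f) ε₀) : m * ε₀ ≤ 1 := by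
  calc m * ε₀ = ∑ _i : Fin m, ε₀ := by simp
    _ ≤ ∑ i, f i := Finset.sum_le_sum fun i _ => hε.2 ⟨i, rfl⟩
    _ = 1 := hs

theorem sqrt_log_div_le {ε : ℝ} (h0 : 0 < ε) (h1 : ε ≤ 1 / 2) {n : ℕ}
    (hn : 16 * Real.log (1 / ε) / ε ^ 2 < n) : Real.sqrt (2 * Real.log n / n) ≤ ε := by
  have hL : Real.log 2 ≤ Real.log (1 / ε) :=
    Real.log_le_log (by norm_num) (by rw [le_div_iff₀ h0]; linarith)
  have hlog2 : 0 < Real.log 2 := Real.log_pos one_lt_two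
  have hL0 := hlog2.trans_le hL
  have hn0 : (0 : ℝ) < n := lt_of_le_of_lt (by positivity) hn
  rw [Real.sqrt_le_left h0.le, div_le_iff₀ hn0]
  rw [div_lt_iff₀ (by positivity)] at hn
  -- Applying `log x ≤ x - 1` after this rescaling leaves only multiples of `n ε ^ 2`, of `log (1 /
  -- ε)` and of `log 2`, which the lower bound on `n` compares.
  have e : Real.log n = Real.log (n * ε ^ 2 / 4) + 2 * Real.log 2 + 2 * Real.log (1 / ε) := by
    rw [← Real.log_rpow two_pos, ← Real.log_rpow (by positivity), ← Real.log_mul, ← Real.log_mul]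
    · congr 1
      norm_num
      field_simp
    all_goals positivity
  have h2 := Real.log_le_sub_one_of_pos (x := n * ε ^ 2 / 4) (by positivity)
  linarith [Real.log_two_lt_d9]

/-! ### Costly decisions force a gap deviation -/

section Path

variable {m : ℕ} {a f : Fin m → ℝ} {ε₀ : ℝ}

theorem mem_gapQuantiles_cdf (ha : StrictMono a) (hf : ∀ i, 0 < f i) (hs : ∑ i, f i = 1) {q : ℝ} :
    q ∈ gapQuantiles (cdf (discreteLaw a f)) a ↔
      ∃ i : Fin m, (i : ℕ) + 1 < m ∧ q = cumMass f (i + 1) := by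
  simp only [gapQuantiles, cdf_discreteLaw ha hf hs]
  rfl

theorem gapQuantiles_separated (ha : StrictMono a) (hf : ∀ i, 0 < f i) (hs : ∑ i, f i = 1)
    (hε : IsLeast (Set.range f) ε₀) :
    ∀ q ∈ gapQuantiles (cdf (discreteLaw a f)) a,
      ∀ q' ∈ gapQuantiles (cdf (discreteLaw a f)) a, q < q' → q + ε₀ ≤ q' := by
  intro q hq q' hq' hlt
  obtain ⟨i, hi, rfl⟩ := (mem_gapQuantiles_cdf ha hf hs).1 hq
  obtain ⟨i', hi', rfl⟩ := (mem_gapQuantiles_cdf ha hf hs).1 hq'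
  have hii : (i : ℕ) + 1 < i' + 1 := (cumMass_mono hf).reflect_lt hlt
  calc cumMass f (i + 1) + ε₀ ≤ cumMass f (i + 1) + f ⟨i + 1, hi⟩ := by
        gcongr; exact hε.2 ⟨_, rfl⟩
    _ = cumMass f (i + 1 + 1) := (cumMass_succ ⟨(i : ℕ) + 1, hi⟩).symm
    _ ≤ cumMass f (i' + 1) := cumMass_mono hf hii

theorem le_of_mem_gapQuantiles (ha : StrictMono a) (hf : ∀ i, 0 < f i) (hs : ∑ i, f i = 1)
    (hε : IsLeast (Set.range f) ε₀) {q : ℝ} (hq : q ∈ gapQuantiles (cdf (discreteLaw a f)) a) :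
    ε₀ ≤ q := by
  obtain ⟨i, hi, rfl⟩ := (mem_gapQuantiles_cdf ha hf hs).1 hq
  rw [cumMass_succ]
  have : 0 ≤ cumMass f i := by
    rw [← cumMass_zero (f := f)]; exact cumMass_mono hf (Nat.zero_le _)
  linarith [hε.2 ⟨i, rfl⟩]

/-- After period `t`, for some gap, the number of later candidates above the gap deviates from
its mean by the confidence radius. -/
def GapDeviation {T : ℕ} (a f : Fin m → ℝ) (ε₀ : ℝ) (v : Fin T → ℝ) (t : Fin T) : Prop :=
  ∃ i : Fin m, (i : ℕ) + 1 < m ∧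
    ((T - t : ℕ) : ℝ) * min (Real.sqrt (2 * Real.log (T - t : ℕ) / (T - t : ℕ))) (ε₀ / 2) ≤
      |((Finset.univ.filter fun s : Fin T => (t : ℕ) + 1 ≤ s ∧ a i < v s).card : ℝ) -
        (((T - t : ℕ) : ℝ) - 1) * (1 - cumMass f (i + 1))|

theorem lt_of_phaseOne {T k : ℕ} (hk : k < phaseOneLength ε₀ T) :
    16 * Real.log (1 / ε₀) / ε₀ ^ 2 < (T - k : ℕ) := by
  rw [phaseOneLength] at hk
  exact Nat.lt_of_floor_lt (by omega)

theorem value_le_of_lt (ha : StrictMono a) (hf : ∀ i, 0 < f i) {T : ℕ} {j : Fin T → Fin m}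
    {X : Fin T → ℝ} (hX : ∀ t, X t ∈ Set.Ioo (cumMass f (j t)) (cumMass f (j t + 1)))
    {r s : Fin T} (h : X r < X s) : a (j r) ≤ a (j s) := by
  rw [ha.le_iff_le]
  by_contra! hlt
  have : cumMass f (j s + 1) ≤ cumMass f (j r) := cumMass_mono hf hlt
  linarith [(hX r).1, (hX s).2]

variable (ha : StrictMono a) (hf : ∀ i, 0 < f i) (hs : ∑ i, f i = 1)
  (hε : IsLeast (Set.range f) ε₀) {p : ℕ → ℕ → ℝ}
  (hp : IsCwGThreshold (gapQuantiles (cdf (discreteLaw a f)) a) p)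
  {T : ℕ} {j : Fin T → Fin m} {X : Fin T → ℝ}
  (hX : ∀ t, X t ∈ Set.Ioo (cumMass f (j t)) (cumMass f (j t + 1)))
  {t : Fin T} {b : ℕ}

include ha hf hs hε hp hX

/-- Let `q` be the gap quantile just above the candidate's atom. A hire means that the threshold is
below `q`, so `b ≥ n (1 - q) + n δ`. Having `b` better later candidates would then exceed the mean
`(n - 1) (1 - q)` by `n δ`. Above the top atom there is nobody. -/
theorem card_better_lt_of_hire (hdev : ¬ GapDeviation a f ε₀ (fun s => a (j s)) t)
    (hb : 0 < b) (h : p (T - t) b ≤ X t) :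
    ((Finset.univ.filter fun s : Fin T => (t : ℕ) + 1 ≤ s).filter
      fun s => a (j t) < a (j s)).card < b := by
  by_contra! hcon
  rw [Finset.filter_filter] at hcon
  have hn : 1 ≤ T - (t : ℕ) := by omega
  have hn' : (0 : ℝ) < (T - t : ℕ) := by exact_mod_cast hn
  by_cases hj : (j t : ℕ) + 1 < m
  · apply hdev
    refine ⟨j t, hj, ?_⟩
    have hq : cumMass f (j t + 1) ∈ gapQuantiles (cdf (discreteLaw a f)) a :=
      (mem_gapQuantiles_cdf ha hf hs).2 ⟨j t, hj, rfl⟩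
    have h1 := hp.ceThreshold_add_le (gapQuantiles_separated ha hf hs hε) hn hq
      (h.trans_lt (hX t).2)
    have hq1 : cumMass f (j t + 1) ≤ 1 := by
      rw [← hs, ← cumMass_top]; exact cumMass_mono hf hj.le
    set δ := min (Real.sqrt (2 * Real.log (T - t : ℕ) / (T - t : ℕ))) (ε₀ / 2)
    have hcard : (b : ℝ) ≤
      (Finset.univ.filter fun s : Fin T => (t : ℕ) + 1 ≤ s ∧ a (j t) < a (j s)).card := by
      exact_mod_cast hcon
    have hbce : (b : ℝ) = (T - t : ℕ) * (1 - ceThreshold b (T - t)) := by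
      rw [ceThreshold]; field_simp; ring
    refine le_trans ?_ (le_abs_self _)
    nlinarith
  · have : (Finset.univ.filter fun s : Fin T => (t : ℕ) + 1 ≤ s ∧ a (j t) < a (j s)) = ∅ := by
      apply Finset.filter_false_of_mem
      rintro s - ⟨-, h2⟩
      have h3 : (j t : ℕ) < j s := ha.lt_iff_lt.1 h2
      omega
    rw [this, Finset.card_empty] at hcon
    omega

/-- Mirror image for the gap just below the candidate's atom. The bottom atom has no such gap: all
`n - 1` later candidates are as good, so a costly rejection would need `b ≥ n`, when the threshold
is nonpositive and nobody is rejected. Only this case uses `hr`. -/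
theorem le_card_of_reject (hdev : ¬ GapDeviation a f ε₀ (fun s => a (j s)) t)
    (hr : 1 < m → Real.sqrt (2 * Real.log (T - t : ℕ) / (T - t : ℕ)) ≤ ε₀)
    (h : X t < p (T - t) b) :
    b ≤ ((Finset.univ.filter fun s : Fin T => (t : ℕ) + 1 ≤ s).filter
      fun s => a (j t) ≤ a (j s)).card := by
  by_contra! hcon
  rw [Finset.filter_filter] at hcon
  have hn : 1 ≤ T - (t : ℕ) := by omega
  have hn' : (0 : ℝ) < (T - t : ℕ) := by exact_mod_cast hn
  by_cases hj : (j t : ℕ) = 0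
  · have hcard : (Finset.univ.filter
        fun s : Fin T => (t : ℕ) + 1 ≤ s ∧ a (j t) ≤ a (j s)).card = T - t - 1 := by
      have h1 : (Finset.univ.filter fun s : Fin T => (t : ℕ) + 1 ≤ s ∧ a (j t) ≤ a (j s)) =
          Finset.Ioi t := by
        ext s
        simp only [Finset.mem_filter, Finset.mem_univ, true_and, Finset.mem_Ioi, ha.le_iff_le,
          Fin.le_def, Fin.lt_def, hj, Nat.zero_le, and_true]
        omega
      rw [h1, Fin.card_Ioi]
      omega
    have h0 := hp.nonpos (n := T - t) (b := b) ?_ hn (by omega)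
    · have := (hX t).1
      rw [hj, cumMass_zero] at this
      linarith
    · intro q hq
      obtain ⟨i, hi, -⟩ := (mem_gapQuantiles_cdf ha hf hs).1 hq
      exact (hr (by omega)).trans (le_of_mem_gapQuantiles ha hf hs hε hq)
  · apply hdev
    have hj1 : (j t : ℕ) - 1 + 1 = j t := by omega
    refine ⟨⟨(j t : ℕ) - 1, by omega⟩, by simp only [hj1]; exact (j t).2, ?_⟩
    have hq : cumMass f (j t) ∈ gapQuantiles (cdf (discreteLaw a f)) a :=
      (mem_gapQuantiles_cdf ha hf hs).2
        ⟨⟨(j t : ℕ) - 1, by omega⟩, by simp only [hj1]; exact (j t).2, by simp only [hj1]⟩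
    have h1 := hp.add_le_ceThreshold (gapQuantiles_separated ha hf hs hε) hn hq
      ((hX t).1.trans h)
    have hq0 : 0 ≤ cumMass f (j t) := by
      rw [← cumMass_zero (f := f)]; exact cumMass_mono hf (Nat.zero_le _)
    set δ := min (Real.sqrt (2 * Real.log (T - t : ℕ) / (T - t : ℕ))) (ε₀ / 2)
    have hset : (Finset.univ.filter fun s : Fin T =>
        (t : ℕ) + 1 ≤ s ∧ a ⟨(j t : ℕ) - 1, by omega⟩ < a (j s)) =
        Finset.univ.filter fun s : Fin T => (t : ℕ) + 1 ≤ s ∧ a (j t) ≤ a (j s) := by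
      ext s
      simp only [Finset.mem_filter, Finset.mem_univ, true_and, ha.le_iff_le, ha.lt_iff_lt,
        Fin.le_def, Fin.lt_def]
      omega
    rw [hset]
    simp only [hj1]
    -- The spare unit pays for the mean being taken over `n - 1` candidates while the certainty
    -- equivalent threshold is computed with `n`.
    have hcard : ((Finset.univ.filter
        fun s : Fin T => (t : ℕ) + 1 ≤ s ∧ a (j t) ≤ a (j s)).card : ℝ) + 1 ≤ b := by
      exact_mod_cast hcon
    have hbce : (b : ℝ) = (T - t : ℕ) * (1 - ceThreshold b (T - t)) := by
      rw [ceThreshold]; field_simp; ring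
    refine le_trans ?_ (neg_le_abs _)
    nlinarith

open Classical in
/-- The pathwise regret of the policy. -/
theorem hindsightValue_le_cwg (ha01 : ∀ i, a i ∈ Set.Icc (0 : ℝ) 1) (B : ℕ) :
    hindsightValue B (fun s => a (j s)) ≤
      ∑ s, (if cwgDecision ε₀ p B X s = true then a (j s) else 0) +
      ∑ s ∈ Finset.univ.filter (fun s : Fin T => (s : ℕ) < phaseOneLength ε₀ T),
        (if GapDeviation a f ε₀ (fun s => a (j s)) s then 1 else 0) +
      |((∑ s ∈ Finset.univ.filter (fun s : Fin T => phaseOneLength ε₀ T ≤ (s : ℕ)),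
          if ceThreshold (budgetAfter (fun s c => p (T - s) c) B X (phaseOneLength ε₀ T))
            (T - phaseOneLength ε₀ T) ≤ X s then 1 else 0 : ℕ) : ℝ) -
        (min (budgetAfter (fun s c => p (T - s) c) B X (phaseOneLength ε₀ T))
          (T - phaseOneLength ε₀ T) : ℕ)| := by
  set k := phaseOneLength ε₀ T with hk
  have hkT : k ≤ T := Nat.sub_le _ _
  set thr := cwgThresholds ε₀ p B X with hthr
  set v : Fin T → ℝ := fun s => a (j s) with hv
  have h0 : ∀ s, 0 ≤ v s := fun s => (ha01 _).1
  have h1 : ∀ s, v s ≤ 1 := fun s => (ha01 _).2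
  have hthr1 : ∀ s < k, ∀ b, thr s b = p (T - s) b := fun s hs b => by
    simp only [hthr, cwgThresholds, ← hk, if_pos hs]
  have hthr2 : ∀ s b, k ≤ s →
      thr s b = ceThreshold (budgetAfter (fun s c => p (T - s) c) B X k) (T - k) :=
    fun s b hs => by simp only [hthr, cwgThresholds, ← hk, if_neg (not_lt.2 hs)]
  have hbk : budgetAfter thr B X k = budgetAfter (fun s c => p (T - s) c) B X k :=
    budgetAfter_congr hthr1
  have hdec : ∀ s, cwgDecision ε₀ p B X s = true ↔ IsHired thr B X s := fun s => by
    simp [cwgDecision, IsHired, hthr]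
  -- Two atoms force `ε₀ ≤ 1 / 2`, as needed for the bound on the radius; with a single atom there
  -- are no gaps.
  have hr : ∀ t : Fin T, (t : ℕ) < k → 1 < m →
      Real.sqrt (2 * Real.log (T - t : ℕ) / (T - t : ℕ)) ≤ ε₀ := by
    intro t ht hm
    have hm' : (2 : ℝ) ≤ m := by exact_mod_cast hm
    obtain ⟨i, hi⟩ := hε.1
    have hpos : 0 < ε₀ := hi ▸ hf i
    refine sqrt_log_div_le hpos ?_ (lt_of_phaseOne ht)
    nlinarith [card_mul_minMass_le_one hs hε]
  have A := offlineFrom_univ_le (thr := thr) (B := B) (X := X) (v := v)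
    (e := fun t => if GapDeviation a f ε₀ v t then 1 else 0) hkT ?_ ?_
  · have C := offlineFrom_le_of_const (thr := thr) (B := B) h0 h1
      (fun s r h => value_le_of_lt ha hf hX h) hthr2 hkT
    rw [hindsightValue_eq_offlineFrom]
    have D := Finset.sum_filter_add_sum_filter_not (Finset.univ : Finset (Fin T))
      (fun s => (s : ℕ) < k) (fun s => if IsHired thr B X s then v s else 0)
    simp only [not_lt] at D
    simp only [hdec]
    rw [hbk] at C A
    linarith
  · intro t ht hh
    have hh1 := hh.1
    rw [hthr1 _ ht] at hh1
    by_cases hd : GapDeviation a f ε₀ v t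
    · rw [if_pos hd]
      exact offlineFrom_insert_le_hire_add_one (h0 t) h1
    · rw [if_neg hd, add_zero]
      exact offlineFrom_insert_le_of_hire (h0 t)
        (card_better_lt_of_hire ha hf hs hε hp hX hd hh.2 hh1)
  · intro t ht hh
    by_cases hd : GapDeviation a f ε₀ v t
    · rw [if_pos hd]
      exact offlineFrom_insert_le_reject_add_one h1
    · rw [if_neg hd, add_zero]
      apply offlineFrom_insert_le_of_reject
      -- A rejection for lack of budget costs nothing.
      rcases Nat.eq_zero_or_pos (budgetAfter thr B X t) with hb | hb
      · rw [hb]; exact Nat.zero_le _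
      · refine le_card_of_reject ha hf hs hε hp hX hd (hr t ht) ?_
        by_contra! hle
        exact hh ⟨by rwa [hthr1 _ ht], hb⟩

end Path


/-! ### Concentration of bounded sums -/

section Concentration

variable {Ω : Type*} [MeasurableSpace Ω] {P : Measure Ω} [IsProbabilityMeasure P]

/-- Two-sided Hoeffding inequality: the one-sided bound is applied to the centred variables and to
their negatives. -/
theorem measureReal_abs_sum_sub_ge_le {ι : Type*} {Y : ι → Ω → ℝ} (hY : ∀ i, Measurable (Y i))
    (h01 : ∀ i ω, Y i ω ∈ Set.Icc (0 : ℝ) 1) (hind : iIndepFun Y P) {c : ℝ}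
    (hc : ∀ i, ∫ ω, Y i ω ∂P = c) (s : Finset ι) {x : ℝ} (hx : 0 ≤ x) :
    P.real {ω | x ≤ |∑ i ∈ s, Y i ω - s.card * c|} ≤ 2 * Real.exp (-(2 * x ^ 2 / s.card)) := by
  have hsub : ∀ i, HasSubgaussianMGF (fun ω => Y i ω - c) ((‖(1 : ℝ) - 0‖₊ / 2) ^ 2) P := by
    intro i
    have := hasSubgaussianMGF_of_mem_Icc (hY i).aemeasurable
      (Filter.Eventually.of_forall (h01 i) : ∀ᵐ ω ∂P, _)
    rwa [hc i] at this
  have hind1 : iIndepFun (fun i ω => Y i ω - c) P :=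
    hind.comp (fun _ y => y - c) (fun _ => by fun_prop)
  have hind2 : iIndepFun (fun i ω => -(Y i ω - c)) P :=
    hind.comp (fun _ y => -(y - c)) (fun _ => by fun_prop)
  have h1 := HasSubgaussianMGF.measure_sum_ge_le_of_iIndepFun hind1 (s := s)
    (fun i _ => hsub i) hx
  have h2 := HasSubgaussianMGF.measure_sum_ge_le_of_iIndepFun hind2 (s := s)
    (fun i _ => (hsub i).neg) hx
  have hexp : -x ^ 2 / (2 * ((∑ _i ∈ s, (‖(1 : ℝ) - 0‖₊ / 2) ^ 2 : NNReal) : ℝ)) =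
      -(2 * x ^ 2 / s.card) := by
    simp only [Finset.sum_const, sub_zero, nnnorm_one, nsmul_eq_mul, NNReal.coe_mul,
      NNReal.coe_natCast, NNReal.coe_pow, NNReal.coe_div, NNReal.coe_one, NNReal.coe_ofNat]
    rcases Nat.eq_zero_or_pos s.card with h | h
    · simp [h]
    · field_simp
  rw [hexp] at h1 h2
  calc P.real {ω | x ≤ |∑ i ∈ s, Y i ω - s.card * c|}
      ≤ P.real ({ω | x ≤ ∑ i ∈ s, (Y i ω - c)} ∪ {ω | x ≤ ∑ i ∈ s, -(Y i ω - c)}) := by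
        apply measureReal_mono
        · intro ω hω
          simp only [Set.mem_ofPred_eq, Set.mem_union, Finset.sum_neg_distrib,
            Finset.sum_sub_distrib, Finset.sum_const, nsmul_eq_mul] at hω ⊢
          exact le_abs.1 hω
        · finiteness
    _ ≤ _ := (measureReal_union_le _ _).trans (by linarith)

theorem integral_abs_sum_sub_le {ι : Type*} {Y : ι → Ω → ℝ} (hY : ∀ i, Measurable (Y i))
    (h01 : ∀ i ω, Y i ω ∈ Set.Icc (0 : ℝ) 1) (s : Finset ι)
    (hind : Set.Pairwise ↑s fun i j => IndepFun (Y i) (Y j) P) {c : ℝ}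
    (hc : ∀ i, ∫ ω, Y i ω ∂P = c) :
    ∫ ω, |∑ i ∈ s, Y i ω - s.card * c| ∂P ≤ Real.sqrt s.card / 2 := by
  have hmem : ∀ i, MemLp (Y i) 2 P := fun i =>
    memLp_of_bounded (Filter.Eventually.of_forall (h01 i)) (hY i).aestronglyMeasurable 2
  have hsum : MemLp (fun ω => ∑ i ∈ s, Y i ω) 2 P := memLp_finsetSum s fun i _ => hmem i
  have hmean : ∫ ω, ∑ i ∈ s, Y i ω ∂P = s.card * c := by
    rw [integral_finsetSum _ fun i _ => (hmem i).integrable (by norm_num)]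
    simp [hc]
  have hZ : MemLp (fun ω => ∑ i ∈ s, Y i ω - s.card * c) 2 P := hsum.sub (memLp_const _)
  have hvar : variance (fun ω => ∑ i ∈ s, Y i ω) P ≤ s.card / 4 := by
    have h1 := IndepFun.variance_sum (s := s) (fun i _ => hmem i) hind
    have h2 : (fun ω => ∑ i ∈ s, Y i ω) = ∑ i ∈ s, Y i := by ext; simp
    rw [h2, h1]
    calc ∑ i ∈ s, variance (Y i) P ≤ ∑ i ∈ s, ((1 - 0) / 2 : ℝ) ^ 2 :=
          Finset.sum_le_sum fun i _ => variance_le_sq_of_bounded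
            (Filter.Eventually.of_forall (h01 i)) (hY i).aemeasurable
      _ = _ := by rw [Finset.sum_const, nsmul_eq_mul]; ring
  rw [variance_eq_integral hsum.aestronglyMeasurable.aemeasurable, hmean] at hvar
  have habs : MemLp (fun ω => |∑ i ∈ s, Y i ω - s.card * c|) 2 P := hZ.abs
  -- Nonnegativity of this variance is the Cauchy–Schwarz bound of the first absolute moment by the
  -- second moment.
  have h3 := variance_nonneg (fun ω => |∑ i ∈ s, Y i ω - s.card * c|) P
  rw [variance_eq_sub habs] at h3
  simp only [Pi.pow_apply, sq_abs] at h3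
  have h4 : (∫ ω, |∑ i ∈ s, Y i ω - s.card * c| ∂P) ^ 2 ≤ (s.card : ℝ) / 4 := by linarith
  have h5 : Real.sqrt s.card / 2 = Real.sqrt (s.card / 4) := by
    rw [Real.sqrt_div (by positivity), show (4 : ℝ) = 2 ^ 2 by norm_num, Real.sqrt_sq (by norm_num)]
  rw [h5]
  exact Real.le_sqrt_of_sq_le h4

end Concentration

/-- The exponent is at least `2 n δ ^ 2`. If δ is the radius, the exponential is at most `n ^ (-4)`.
If δ is `ε / 2`, the length of the second phase supplies the decay. -/
theorem two_mul_exp_le {ε : ℝ} (h0 : 0 < ε) (h1 : ε ≤ 1 / 2) {n : ℕ}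
    (hn : 16 * Real.log (1 / ε) / ε ^ 2 < n) :
    2 * Real.exp (-(2 * (n * min (Real.sqrt (2 * Real.log n / n)) (ε / 2)) ^ 2 / (n - 1 : ℕ))) ≤
      64 * ((n : ℝ) ^ 2)⁻¹ := by
  have hL : Real.log 2 ≤ Real.log (1 / ε) :=
    Real.log_le_log (by norm_num) (by rw [le_div_iff₀ h0]; linarith)
  have hlog2 := Real.log_two_gt_d9
  have hn' := (div_lt_iff₀ (by positivity)).1 hn
  have hn2 : 2 ≤ n := by
    by_contra! hlt
    have : (n : ℝ) ≤ 1 := by exact_mod_cast Nat.lt_succ_iff.1 hlt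
    have h2 : ε ^ 2 ≤ 1 := by nlinarith
    have : (n : ℝ) * ε ^ 2 ≤ 1 := by nlinarith [sq_nonneg ε]
    linarith
  have hnpos : (0 : ℝ) < n := by positivity
  have hn1 : (0 : ℝ) < (n - 1 : ℕ) := by exact_mod_cast (by omega : 0 < n - 1)
  have hnn : ((n - 1 : ℕ) : ℝ) ≤ n := by exact_mod_cast Nat.sub_le _ _
  set δ := min (Real.sqrt (2 * Real.log n / n)) (ε / 2) with hδ
  have hlogn : 0 ≤ Real.log n := Real.log_nonneg (by exact_mod_cast (by omega : 1 ≤ n))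
  have key : 2 * n * δ ^ 2 ≤ 2 * (n * δ) ^ 2 / (n - 1 : ℕ) := by
    rw [le_div_iff₀ hn1]
    have : 0 ≤ n * δ ^ 2 := by positivity
    nlinarith
  have h3 : Real.exp (-(2 * (n * δ) ^ 2 / (n - 1 : ℕ))) ≤ Real.exp (-(2 * n * δ ^ 2)) :=
    Real.exp_le_exp.2 (neg_le_neg key)
  have h4 : Real.exp (-(2 * n * δ ^ 2)) ≤ 32 * ((n : ℝ) ^ 2)⁻¹ := by
    rcases min_choice (Real.sqrt (2 * Real.log n / n)) (ε / 2) with h | h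
    · rw [hδ, h, Real.sq_sqrt (by positivity)]
      have e : -(2 * n * (2 * Real.log n / n)) = -(Real.log (n ^ 4)) := by
        rw [Real.log_pow]; field_simp; norm_num; ring
      rw [e, Real.exp_neg, Real.exp_log (by positivity)]
      have : ((n : ℝ) ^ 4)⁻¹ ≤ ((n : ℝ) ^ 2)⁻¹ := by
        gcongr
        · exact_mod_cast (by omega : 1 ≤ n)
        · norm_num
      have : 0 ≤ ((n : ℝ) ^ 2)⁻¹ := by positivity
      linarith
    · rw [hδ, h]
      -- The exponential splits into two factors `exp (-x)`. Since `x > 4 log (1 / ε)`, one is at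
      -- most `ε ^ 4`; this cancels the `ε ^ (-4)` in the bound `2 / x ^ 2` of the other.
      set x := n * ε ^ 2 / 4 with hx
      have hxpos : 0 < x := by positivity
      have e : -(2 * n * (ε / 2) ^ 2) = -x + -x := by rw [hx]; ring
      have e1 : Real.exp (-x) ≤ ε ^ 4 := by
        rw [← Real.exp_log (pow_pos h0 4), Real.log_pow, Real.exp_le_exp]
        rw [one_div, Real.log_inv] at hn'
        push_cast
        linarith
      have e2 : Real.exp (-x) ≤ 2 / x ^ 2 := by
        rw [Real.exp_neg, ← one_div, div_le_div_iff₀ (Real.exp_pos _) (by positivity)]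
        nlinarith [Real.quadratic_le_exp_of_nonneg hxpos.le]
      rw [e, Real.exp_add]
      calc Real.exp (-x) * Real.exp (-x) ≤ ε ^ 4 * (2 / x ^ 2) := by gcongr
        _ = _ := by rw [hx]; field_simp; norm_num
  linarith


/-! ### Laws of the abilities and of the sampled quantiles -/

section Sampling

variable {Ω : Type*} [MeasurableSpace Ω] {P : Measure Ω} {m : ℕ} {a f : Fin m → ℝ} {T : ℕ}
  {θ U : Fin T → Ω → ℝ}

theorem IsSampling.measurable_elim {law : Measure ℝ} (h : IsSampling P law θ U) (i : Fin T ⊕ Fin T) :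
    Measurable (Sum.elim θ U i) := by
  rcases i with i | i
  · exact h.measurable_ability i
  · exact h.measurable_aux i

theorem IsSampling.ae_mem_range (h : IsSampling P (discreteLaw a f) θ U) :
    ∀ᵐ ω ∂P, ∀ t, θ t ω ∈ Set.range a := by
  rw [ae_all_iff]
  intro t
  have hms : MeasurableSet (Set.range a) := (Set.finite_range a).measurableSet
  have : ∀ᵐ x ∂(P.map (θ t)), x ∈ Set.range a := by
    rw [h.law_ability t, ae_iff, discreteLaw]
    simp only [Measure.coe_finsetSum, Finset.sum_apply, Measure.smul_apply, smul_eq_mul]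
    apply Finset.sum_eq_zero
    intro i _
    rw [← Set.compl_def, Measure.dirac_apply' _ hms.compl]
    simp
  exact (ae_map_iff (h.measurable_ability t).aemeasurable hms).1 this

theorem IsSampling.ae_aux_mem {law : Measure ℝ} (h : IsSampling P law θ U) :
    ∀ᵐ ω ∂P, ∀ t, U t ω ∈ Set.Ioo (0 : ℝ) 1 := by
  rw [ae_all_iff]
  intro t
  have : ∀ᵐ x ∂(P.map (U t)), x ∈ Set.Ioo (0 : ℝ) 1 := by
    rw [h.law_aux t, ← restrict_Ioo_eq_restrict_Icc]
    exact ae_restrict_mem measurableSet_Ioo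
  exact (ae_map_iff (h.measurable_aux t).aemeasurable measurableSet_Ioo).1 this

theorem IsSampling.measureReal_ability_eq (hf : ∀ i, 0 < f i) (ha : StrictMono a)
    (h : IsSampling P (discreteLaw a f) θ U) (t : Fin T) (i : Fin m) :
    P.real (θ t ⁻¹' {a i}) = f i := by
  classical
  rw [← map_measureReal_apply (h.measurable_ability t) (measurableSet_singleton _),
    h.law_ability, discreteLaw_real_apply hf (measurableSet_singleton _)]
  simp [ha.injective.eq_iff, Finset.filter_eq']

theorem IsSampling.measureReal_lt_ability (hf : ∀ i, 0 < f i) (hs : ∑ i, f i = 1)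
    (ha : StrictMono a) (h : IsSampling P (discreteLaw a f) θ U) (t : Fin T) (i : Fin m) :
    P.real {ω | a i < θ t ω} = 1 - cumMass f (i + 1) := by
  classical
  have := isProbabilityMeasure_discreteLaw (a := a) hf hs
  have e : {ω | a i < θ t ω} = θ t ⁻¹' (Set.Iic (a i))ᶜ := by ext; simp
  rw [e, ← map_measureReal_apply (h.measurable_ability t) measurableSet_Iic.compl,
    h.law_ability, probReal_compl_eq_one_sub measurableSet_Iic, ← cdf_eq_real,
    cdf_discreteLaw ha hf hs]

/-- Both sides are the length of the part of `[c, c + d]` above `q`; the right-hand form telescopes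
over adjacent intervals. -/
theorem mul_measureReal_aux {law : Measure ℝ} (h : IsSampling P law θ U) (t : Fin T)
    {c d q : ℝ} (hd : 0 < d) :
    d * P.real (U t ⁻¹' {u | q ≤ c + u * d}) = max (c + d) q - max c q := by
  have hms : MeasurableSet {u : ℝ | q ≤ c + u * d} :=
    measurableSet_le measurable_const (by fun_prop)
  rw [← map_measureReal_apply (h.measurable_aux t) hms, h.law_aux, measureReal_restrict_apply hms]
  have e : {u : ℝ | q ≤ c + u * d} ∩ Set.Icc 0 1 = Set.Icc (max 0 ((q - c) / d)) 1 := by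
    ext u
    simp only [Set.mem_inter_iff, Set.mem_ofPred_eq, Set.mem_Icc, max_le_iff, div_le_iff₀ hd]
    constructor
    · rintro ⟨h1, h2, h3⟩; exact ⟨⟨h2, by linarith⟩, h3⟩
    · rintro ⟨⟨h1, h2⟩, h3⟩; exact ⟨by linarith, h1, h3⟩
  rw [e, Real.volume_real_Icc]
  have hy : d * ((q - c) / d) = q - c := by field_simp
  set y := (q - c) / d
  rcases le_total 0 y with h1 | h1 <;> rcases le_total y 1 with h2 | h2
  · rw [max_eq_right h1, max_eq_left (by linarith), max_eq_left (by nlinarith),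
      max_eq_right (by nlinarith)]; linarith
  · rw [max_eq_right h1, max_eq_right (by linarith), max_eq_right (by nlinarith),
      max_eq_right (by nlinarith)]; linarith
  · rw [max_eq_left h1, max_eq_left (by linarith), max_eq_left (by nlinarith),
      max_eq_left (by nlinarith)]; linarith
  · linarith

variable (ha : StrictMono a) (ha01 : ∀ i, a i ∈ Set.Icc (0 : ℝ) 1) (hf : ∀ i, 0 < f i)
  (hs : ∑ i, f i = 1) (h : IsSampling P (discreteLaw a f) θ U)

include ha ha01 hf hs h

theorem measurable_sampled (t : Fin T) :
    Measurable fun ω => quantileSample (cdf (discreteLaw a f)) (θ t ω) (U t ω) :=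
  (measurable_quantileSample ha ha01 hf hs).comp
    ((h.measurable_ability t).prodMk (h.measurable_aux t))

/-- The sampled quantile is uniform on `[0, 1]`: splitting by atom and using independence of ability
and auxiliary variable, the contributions telescope. Negative `q` is allowed, because certainty
equivalent thresholds can be negative. -/
theorem measureReal_le_sampled [IsProbabilityMeasure P] (t : Fin T) {q : ℝ} (hq : q ≤ 1) :
    P.real {ω | q ≤ quantileSample (cdf (discreteLaw a f)) (θ t ω) (U t ω)} = 1 - max 0 q := by
  have hms : MeasurableSet {ω | q ≤ quantileSample (cdf (discreteLaw a f)) (θ t ω) (U t ω)} :=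
    measurableSet_le measurable_const (measurable_sampled ha ha01 hf hs h t)
  have hind : IndepFun (θ t) (U t) P :=
    h.indep.indepFun (i := Sum.inl t) (j := Sum.inr t) (by simp)
  have hmj : ∀ j : Fin m, MeasurableSet {u : ℝ | q ≤ cumMass f j + u * f j} := fun j =>
    measurableSet_le measurable_const (by fun_prop)
  have hcover : P.real {ω | q ≤ quantileSample (cdf (discreteLaw a f)) (θ t ω) (U t ω)} =
      P.real (⋃ j ∈ (Finset.univ : Finset (Fin m)),
        (θ t ⁻¹' {a j} ∩ U t ⁻¹' {u | q ≤ cumMass f j + u * f j})) := by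
    apply measureReal_congr
    filter_upwards [h.ae_mem_range] with ω hω
    obtain ⟨j, hj⟩ := hω t
    apply propext
    simp only [Finset.mem_univ, Set.iUnion_true]
    constructor
    · intro h1
      refine Set.mem_iUnion.2 ⟨j, hj.symm, ?_⟩
      change q ≤ quantileSample _ _ _ at h1
      rwa [← hj, quantileSample_eq ha ha01 hf hs] at h1
    · intro h1
      obtain ⟨i, hi, h2⟩ := Set.mem_iUnion.1 h1
      change q ≤ quantileSample _ _ _
      rw [show θ t ω = a i from hi, quantileSample_eq ha ha01 hf hs]
      exact h2
  rw [hcover, measureReal_biUnion_finset]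
  · rw [← max_eq_left hq, max_comm 0 q, max_comm q 0, ← sum_telescope_cumMass hs fun x => max x q]
    apply Finset.sum_congr rfl
    intro j _
    rw [Measure.real, hind.measure_inter_preimage_eq_mul _ _ (measurableSet_singleton _) (hmj j),
      ENNReal.toReal_mul, ← Measure.real, ← Measure.real, h.measureReal_ability_eq hf ha,
      mul_measureReal_aux h t (hf j), cumMass_succ]
  · intro i _ j _ hij
    refine Disjoint.mono Set.inter_subset_left Set.inter_subset_left ?_
    exact Disjoint.preimage _ (by simpa using ha.injective.ne hij)
  · intro j _
    exact ((h.measurable_ability t) (measurableSet_singleton _)).inter (h.measurable_aux t (hmj j))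

omit ha01 in
theorem measureReal_gapDeviation_le [IsProbabilityMeasure P] {ε₀ : ℝ}
    (hε : IsLeast (Set.range f) ε₀) (t : Fin T)
    (ht : 16 * Real.log (1 / ε₀) / ε₀ ^ 2 < (T - t : ℕ)) :
    P.real {ω | GapDeviation a f ε₀ (fun s => θ s ω) t} ≤
      (m - 1 : ℕ) * (64 * (((T - t : ℕ) : ℝ) ^ 2)⁻¹) := by
  classical
  have hpos : 0 < ε₀ := by obtain ⟨i, hi⟩ := hε.1; exact hi ▸ hf i
  set n := T - (t : ℕ) with hn
  set x := (n : ℝ) * min (Real.sqrt (2 * Real.log n / n)) (ε₀ / 2) with hx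
  have hx0 : 0 ≤ x := by positivity
  set Y : Fin m → Fin T → Ω → ℝ := fun i s ω => if a i < θ s ω then 1 else 0 with hY
  have hYm : ∀ i s, Measurable (Y i s) := fun i s =>
    Measurable.ite (measurableSet_lt measurable_const (h.measurable_ability s))
      measurable_const measurable_const
  have hθ : iIndepFun θ P := h.indep.precomp (g := Sum.inl) Sum.inl_injective
  have hYind : ∀ i, iIndepFun (Y i) P := fun i =>
    hθ.comp (fun _ y => if a i < y then 1 else 0) fun _ =>
      Measurable.ite (measurableSet_lt measurable_const measurable_id)
        measurable_const measurable_const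
  have hYint : ∀ i s, ∫ ω, Y i s ω ∂P = 1 - cumMass f (i + 1) := by
    intro i s
    rw [← h.measureReal_lt_ability hf hs ha s i, ← integral_indicator_one
      (measurableSet_lt measurable_const (h.measurable_ability s))]
    congr 1
  have hcard : (Finset.univ.filter fun s : Fin T => (t : ℕ) + 1 ≤ s).card = n - 1 := by
    have : (Finset.univ.filter fun s : Fin T => (t : ℕ) + 1 ≤ s) = Finset.Ioi t := by
      ext s
      simp only [Finset.mem_filter, Finset.mem_univ, true_and, Finset.mem_Ioi, Fin.lt_def]
      omega
    rw [this, Fin.card_Ioi]; omega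
  have hcast : ((n - 1 : ℕ) : ℝ) = n - 1 := by
    rw [Nat.cast_sub (by omega), Nat.cast_one]
  have hsub : {ω | GapDeviation a f ε₀ (fun s => θ s ω) t} ⊆
      ⋃ i ∈ Finset.univ.filter (fun i : Fin m => (i : ℕ) + 1 < m),
        {ω | x ≤ |∑ s ∈ Finset.univ.filter (fun s : Fin T => (t : ℕ) + 1 ≤ s), Y i s ω -
          (Finset.univ.filter fun s : Fin T => (t : ℕ) + 1 ≤ s).card *
            (1 - cumMass f (i + 1))|} := by
    rintro ω ⟨i, hi, hdev⟩
    simp only [Set.mem_iUnion]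
    refine ⟨i, by simpa using hi, ?_⟩
    simp only [Set.mem_ofPred_eq, hY]
    rw [Finset.sum_boole, Finset.filter_filter, hcard, hcast]
    exact hdev
  have hcard2 : (Finset.univ.filter (fun i : Fin m => (i : ℕ) + 1 < m)).card = m - 1 := by
    have := Fin.card_filter_val_lt (n := m) (m := m - 1)
    rw [min_eq_right (by omega)] at this
    rw [← this]
    congr 1
    ext i
    simp only [Finset.mem_filter, Finset.mem_univ, true_and]
    omega
  calc _ ≤ _ := measureReal_mono hsub (measure_ne_top _ _)
    _ ≤ _ := measureReal_biUnion_finset_le _ _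
    _ ≤ ∑ i ∈ Finset.univ.filter (fun i : Fin m => (i : ℕ) + 1 < m),
        64 * ((n : ℝ) ^ 2)⁻¹ := by
      apply Finset.sum_le_sum
      intro i hi
      simp only [Finset.mem_filter, Finset.mem_univ, true_and] at hi
      refine (measureReal_abs_sum_sub_ge_le (hYm i) ?_ (hYind i) (hYint i) _ hx0).trans ?_
      · intro s ω
        simp only [hY]
        split_ifs <;> simp
      · rw [hcard]
        refine two_mul_exp_le hpos ?_ ht
        have hm' : (2 : ℝ) ≤ m := by exact_mod_cast (by omega : 2 ≤ m)
        nlinarith [card_mul_minMass_le_one hs hε]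
    _ = _ := by rw [Finset.sum_const, hcard2, nsmul_eq_mul]

open Classical in
theorem integral_abs_count_sub_le [IsProbabilityMeasure P] (k b : ℕ) (hk : k ≤ T) :
    ∫ ω, |((∑ s ∈ Finset.univ.filter (fun s : Fin T => k ≤ (s : ℕ)),
        if ceThreshold b (T - k) ≤ quantileSample (cdf (discreteLaw a f)) (θ s ω) (U s ω)
          then 1 else 0 : ℕ) : ℝ) - (min b (T - k) : ℕ)| ∂P ≤ Real.sqrt (T - k : ℕ) / 2 := by
  set q := ceThreshold b (T - k) with hq
  set Y : Fin T → Ω → ℝ := fun s ω =>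
    if q ≤ quantileSample (cdf (discreteLaw a f)) (θ s ω) (U s ω) then 1 else 0 with hY
  have hYm : ∀ s, Measurable (Y s) := fun s =>
    Measurable.ite (measurableSet_le measurable_const (measurable_sampled ha ha01 hf hs h s))
      measurable_const measurable_const
  have hq1 : q ≤ 1 := by
    rw [hq, ceThreshold, sub_le_self_iff]; positivity
  have hYint : ∀ s, ∫ ω, Y s ω ∂P = 1 - max 0 q := by
    intro s
    rw [← measureReal_le_sampled ha ha01 hf hs h s hq1, ← integral_indicator_one
      (measurableSet_le measurable_const (measurable_sampled ha ha01 hf hs h s))]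
    congr 1
  have hpair : ∀ A : Set (Fin T), A.Pairwise fun s r => IndepFun (Y s) (Y r) P := by
    intro A s _ r _ hsr
    have := h.indep.indepFun_prodMk_prodMk h.measurable_elim (Sum.inl s) (Sum.inr s)
      (Sum.inl r) (Sum.inr r) (by simpa using hsr) (by simp) (by simp) (by simpa using hsr)
    have hg : Measurable fun z : ℝ × ℝ =>
        if q ≤ quantileSample (cdf (discreteLaw a f)) z.1 z.2 then (1 : ℝ) else 0 :=
      Measurable.ite (measurableSet_le measurable_const
        (measurable_quantileSample ha ha01 hf hs)) measurable_const measurable_const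
    exact this.comp hg hg
  have hcard : (Finset.univ.filter fun s : Fin T => k ≤ (s : ℕ)).card = T - k := by
    have h1 := Fin.card_filter_val_lt (n := T) (m := k)
    have h2 := Finset.card_filter_add_card_filter_not (s := (Finset.univ : Finset (Fin T)))
      (fun s => (s : ℕ) < k)
    simp only [not_lt, Finset.card_univ, Fintype.card_fin] at h2
    omega
  have key := integral_abs_sum_sub_le hYm
    (fun s ω => by simp only [hY]; split_ifs <;> simp)
    (Finset.univ.filter fun s : Fin T => k ≤ (s : ℕ)) (hpair _) hYint
  -- The certainty equivalent threshold is calibrated so that the expected number of candidates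
  -- above it is exactly the number that can be hired.
  have hmean : ((T - k : ℕ) : ℝ) * (1 - max 0 q) = (min b (T - k) : ℕ) := by
    rcases Nat.eq_zero_or_pos (T - k) with h0 | h0
    · simp [h0]
    · have h0' : (0 : ℝ) < (T - k : ℕ) := by exact_mod_cast h0
      have hb : ((T - k : ℕ) : ℝ) * (1 - q) = b := by rw [hq, ceThreshold]; field_simp; ring
      rcases le_total b (T - k) with h1 | h1
      · have h1' : (b : ℝ) ≤ (T - k : ℕ) := by exact_mod_cast h1
        rw [min_eq_left h1, max_eq_right (by nlinarith), hb]
      · have h1' : ((T - k : ℕ) : ℝ) ≤ b := by exact_mod_cast h1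
        rw [min_eq_right h1, max_eq_left (by nlinarith)]; ring
  rw [hcard, hmean] at key
  convert key using 5 with ω
  push_cast
  rfl

end Sampling


/-! ### Measurability of the budget process -/

theorem budgetAfter_le {T : ℕ} {thr : ℕ → ℕ → ℝ} {B : ℕ} {X : Fin T → ℝ} (t : ℕ) :
    budgetAfter thr B X t ≤ B := by
  induction t with
  | zero => exact le_rfl
  | succ t ih =>
    rw [budgetAfter]
    split_ifs <;> omega

/-- The threshold is evaluated at a random budget, which takes countably many values; on each of
them the budget is constant. -/
theorem measurableSet_hire {Ω : Type*} {mΩ : MeasurableSpace Ω} {thr : Ω → ℕ → ℝ} {b : Ω → ℕ}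
    {x : Ω → ℝ} (hthr : ∀ c, Measurable fun ω => thr ω c) (hb : Measurable b)
    (hx : Measurable x) : MeasurableSet {ω | thr ω (b ω) ≤ x ω ∧ 0 < b ω} := by
  have : {ω | thr ω (b ω) ≤ x ω ∧ 0 < b ω} =
      ⋃ c : ℕ, (b ⁻¹' {c} ∩ {ω | thr ω c ≤ x ω ∧ 0 < c}) := by
    ext ω
    simp
  rw [this]
  refine MeasurableSet.iUnion fun c => (hb (measurableSet_singleton c)).inter ?_
  exact (measurableSet_le (hthr c) hx).inter (MeasurableSet.const _)

/-- The thresholds are allowed to be random but predictable, since those of the second phase depend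
on the path. -/
theorem measurable_budgetAfter {Ω : Type*} {T : ℕ} {ℱ : ℕ → MeasurableSpace Ω} (hℱ : Monotone ℱ)
    {X : Ω → Fin T → ℝ} (hX : ∀ s : Fin T, Measurable[ℱ (s + 1)] fun ω => X ω s)
    {thr : Ω → ℕ → ℕ → ℝ} (B : ℕ) {k : ℕ}
    (hthr : ∀ t < k, ∀ c, Measurable[ℱ t] fun ω => thr ω t c) :
    Measurable[ℱ k] fun ω => budgetAfter (thr ω) B (X ω) k := by
  classical
  induction k with
  | zero => exact measurable_const
  | succ t ih =>
    have ih := (ih fun s hs => hthr s (by omega)).mono (hℱ (Nat.le_succ t)) le_rfl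
    by_cases ht : t < T
    · have hset := measurableSet_hire (mΩ := ℱ (t + 1))
        (fun c => (hthr t (Nat.lt_succ_self t) c).mono (hℱ (Nat.le_succ t)) le_rfl) ih
        (hX ⟨t, ht⟩)
      have e : (fun ω => budgetAfter (thr ω) B (X ω) (t + 1)) = fun ω =>
          if thr ω t (budgetAfter (thr ω) B (X ω) t) ≤ X ω ⟨t, ht⟩ ∧
            0 < budgetAfter (thr ω) B (X ω) t then budgetAfter (thr ω) B (X ω) t - 1
          else budgetAfter (thr ω) B (X ω) t := by
        funext ω
        rw [budgetAfter]
        simp only [exists_prop_of_true ht]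
      rw [e]
      refine Measurable.ite hset ?_ ih
      exact (measurable_of_countable fun n : ℕ => n - 1).comp ih
    · have e : (fun ω => budgetAfter (thr ω) B (X ω) (t + 1)) =
          fun ω => budgetAfter (thr ω) B (X ω) t := by
        funext ω
        rw [budgetAfter, if_neg (fun h => ht h.1)]
      rw [e]
      exact ih

/-! ### Independence of past and future -/

section History

variable {Ω : Type*} {T : ℕ}

/-- The σ-algebra generated by the abilities and auxiliary variables of the first `k` periods. -/
@[reducible] def past (θ U : Fin T → Ω → ℝ) (k : ℕ) : MeasurableSpace Ω :=
  ⨆ i ∈ {i : Fin T ⊕ Fin T | (Sum.elim Fin.val Fin.val i : ℕ) < k},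
    MeasurableSpace.comap (Sum.elim θ U i) inferInstance

/-- The σ-algebra generated by the abilities and auxiliary variables after the first `k`
periods. -/
@[reducible] def future (θ U : Fin T → Ω → ℝ) (k : ℕ) : MeasurableSpace Ω :=
  ⨆ i ∈ {i : Fin T ⊕ Fin T | k ≤ (Sum.elim Fin.val Fin.val i : ℕ)},
    MeasurableSpace.comap (Sum.elim θ U i) inferInstance

variable {θ U : Fin T → Ω → ℝ}

theorem past_mono : Monotone (past θ U) := fun _ _ h =>
  biSup_mono fun _ hi => lt_of_lt_of_le hi h

theorem past_le_history (t : Fin T) : past θ U (t + 1) ≤ history θ U t := by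
  refine iSup₂_le fun i hi => ?_
  rcases i with s | s
  · have hs : s ≤ t := Nat.lt_succ_iff.1 hi
    exact le_trans le_sup_left (le_iSup₂_of_le (f := fun (s : Fin T) (_ : s ≤ t) =>
      MeasurableSpace.comap (θ s) inferInstance ⊔ MeasurableSpace.comap (U s) inferInstance)
      s hs le_rfl)
  · have hs : s ≤ t := Nat.lt_succ_iff.1 hi
    exact le_trans le_sup_right (le_iSup₂_of_le (f := fun (s : Fin T) (_ : s ≤ t) =>
      MeasurableSpace.comap (θ s) inferInstance ⊔ MeasurableSpace.comap (U s) inferInstance)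
      s hs le_rfl)

theorem measurable_past {i : Fin T ⊕ Fin T} {k : ℕ} (hi : Sum.elim Fin.val Fin.val i < k) :
    Measurable[past θ U k] (Sum.elim θ U i) :=
  (comap_measurable (Sum.elim θ U i)).mono (le_iSup₂_of_le (f := fun (i : Fin T ⊕ Fin T)
    (_ : i ∈ {i : Fin T ⊕ Fin T | (Sum.elim Fin.val Fin.val i : ℕ) < k}) =>
    MeasurableSpace.comap (Sum.elim θ U i) inferInstance) i hi le_rfl) le_rfl

theorem measurable_future {i : Fin T ⊕ Fin T} {k : ℕ} (hi : k ≤ Sum.elim Fin.val Fin.val i) :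
    Measurable[future θ U k] (Sum.elim θ U i) :=
  (comap_measurable (Sum.elim θ U i)).mono (le_iSup₂_of_le (f := fun (i : Fin T ⊕ Fin T)
    (_ : i ∈ {i : Fin T ⊕ Fin T | k ≤ (Sum.elim Fin.val Fin.val i : ℕ)}) =>
    MeasurableSpace.comap (Sum.elim θ U i) inferInstance) i hi le_rfl) le_rfl

theorem IsSampling.indep_past_future [MeasurableSpace Ω] {P : Measure Ω} {law : Measure ℝ}
    (h : IsSampling P law θ U) (k : ℕ) : Indep (past θ U k) (future θ U k) P := by
  refine indep_iSup_of_disjoint (fun i => (h.measurable_elim i).comap_le) h.indep ?_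
  rw [Set.disjoint_left]
  intro i (h1 : (Sum.elim Fin.val Fin.val i : ℕ) < k) (h2 : k ≤ Sum.elim Fin.val Fin.val i)
  exact h1.not_ge h2

theorem IsSampling.past_le [mΩ : MeasurableSpace Ω] {P : Measure Ω} {law : Measure ℝ}
    (h : IsSampling P law θ U) (k : ℕ) : past θ U k ≤ mΩ :=
  iSup₂_le fun i _ => (h.measurable_elim i).comap_le

end History

/-! ### Feasibility of the policy and the mismatch in the second phase -/

section Policy

variable {Ω : Type*} [MeasurableSpace Ω] {P : Measure Ω} {m : ℕ} {a f : Fin m → ℝ} {T : ℕ}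
  {θ U : Fin T → Ω → ℝ} {ε₀ : ℝ} {p : ℕ → ℕ → ℝ} {B : ℕ}

open Classical in
theorem cwgDecision_eq_true_iff {X : Fin T → ℝ} {t : Fin T} :
    cwgDecision ε₀ p B X t = true ↔ IsHired (cwgThresholds ε₀ p B X) B X t := by
  simp [cwgDecision, IsHired]

theorem card_filter_cwgDecision_le (X : Fin T → ℝ) :
    (Finset.univ.filter fun t => cwgDecision ε₀ p B X t = true).card ≤ B := by
  classical
  simp only [cwgDecision_eq_true_iff]
  exact card_isHired_le

variable (ha : StrictMono a) (ha01 : ∀ i, a i ∈ Set.Icc (0 : ℝ) 1) (hf : ∀ i, 0 < f i)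
  (hs : ∑ i, f i = 1)

include ha ha01 hf hs

omit [MeasurableSpace Ω] in
theorem measurable_past_sampled (t : Fin T) : Measurable[past θ U (t + 1)]
    fun ω => quantileSample (cdf (discreteLaw a f)) (θ t ω) (U t ω) := by
  have h1 : Measurable[past θ U (t + 1)] (θ t) :=
    measurable_past (i := Sum.inl t) (Nat.lt_succ_self t)
  have h2 : Measurable[past θ U (t + 1)] (U t) :=
    measurable_past (i := Sum.inr t) (Nat.lt_succ_self t)
  exact (measurable_quantileSample ha ha01 hf hs).comp (h1.prodMk h2)

omit [MeasurableSpace Ω] in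
theorem measurable_future_sampled {k : ℕ} {t : Fin T} (ht : k ≤ t) : Measurable[future θ U k]
    fun ω => quantileSample (cdf (discreteLaw a f)) (θ t ω) (U t ω) := by
  have h1 : Measurable[future θ U k] (θ t) := measurable_future (i := Sum.inl t) ht
  have h2 : Measurable[future θ U k] (U t) := measurable_future (i := Sum.inr t) ht
  exact (measurable_quantileSample ha ha01 hf hs).comp (h1.prodMk h2)

omit [MeasurableSpace Ω] in
theorem measurable_cwgPolicy (t : Fin T) : Measurable[history θ U t]
    (cwgPolicy (cdf (discreteLaw a f)) ε₀ p B θ U t) := by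
  classical
  set X : Ω → Fin T → ℝ := fun ω s =>
    quantileSample (cdf (discreteLaw a f)) (θ s ω) (U s ω) with hXdef
  have hX : ∀ s : Fin T, Measurable[past θ U (s + 1)] fun ω => X ω s :=
    measurable_past_sampled ha ha01 hf hs
  set thr : Ω → ℕ → ℕ → ℝ := fun ω => cwgThresholds ε₀ p B (X ω) with hthrdef
  have hthr : ∀ t c, Measurable[past θ U t] fun ω => thr ω t c := by
    intro t c
    by_cases ht : t < phaseOneLength ε₀ T
    · simp only [hthrdef, cwgThresholds, if_pos ht]
      exact measurable_const
    -- The second-phase threshold depends on the path only through the budget at the end of the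
    -- first phase, which is already known.
    · simp only [hthrdef, cwgThresholds, if_neg ht]
      have := (measurable_budgetAfter past_mono hX (thr := fun _ s c => p (T - s) c) B
        (k := phaseOneLength ε₀ T) (fun _ _ _ => measurable_const)).mono
        (past_mono (not_lt.1 ht)) le_rfl
      exact (measurable_of_countable fun n : ℕ => ceThreshold n (T - phaseOneLength ε₀ T)).comp this
  have hb := measurable_budgetAfter past_mono hX (thr := thr) B (k := t) fun s _ c => hthr s c
  have hle : past θ U t ≤ past θ U (t + 1) := past_mono (Nat.le_succ t)
  have hset := measurableSet_hire (mΩ := past θ U (t + 1))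
    (fun c => (hthr t c).mono hle le_rfl) (hb.mono hle le_rfl) (hX t)
  have hset' := past_le_history t _ hset
  refine @measurable_to_bool _ (history θ U t) _ ?_
  convert hset' using 1
  ext ω
  simp [cwgPolicy, cwgDecision, hthrdef, hXdef]

theorem cwgPolicy_mem_feasiblePolicies :
    cwgPolicy (cdf (discreteLaw a f)) ε₀ p B θ U ∈ feasiblePolicies P θ U B :=
  ⟨measurable_cwgPolicy ha ha01 hf hs,
    Filter.Eventually.of_forall fun _ => card_filter_cwgDecision_le _⟩

/-- The mismatch between the number of candidates from period `k + 1` on that are above the certainty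
equivalent threshold for the budget `b`, and the number of them that can be hired. -/
def hiringMismatch (F : ℝ → ℝ) (k b : ℕ) (θ U : Fin T → Ω → ℝ) (ω : Ω) : ℝ :=
  open Classical in
  |((∑ s ∈ Finset.univ.filter (fun s : Fin T => k ≤ (s : ℕ)),
      if ceThreshold b (T - k) ≤ quantileSample F (θ s ω) (U s ω) then 1 else 0 : ℕ) : ℝ) -
    (min b (T - k) : ℕ)|

omit [MeasurableSpace Ω] ha ha01 hf hs in
theorem hiringMismatch_mem_Icc (F : ℝ → ℝ) (k b : ℕ) (ω : Ω) :
    hiringMismatch F k b θ U ω ∈ Set.Icc (0 : ℝ) T := by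
  classical
  refine ⟨abs_nonneg _, ?_⟩
  have h1 : (∑ s ∈ Finset.univ.filter (fun s : Fin T => k ≤ (s : ℕ)),
      if ceThreshold b (T - k) ≤ quantileSample F (θ s ω) (U s ω) then 1 else 0 : ℕ) ≤ T := by
    rw [Finset.sum_boole, Nat.cast_id]
    exact (Finset.card_filter_le _ _).trans ((Finset.card_filter_le _ _).trans (by simp))
  have h2 : min b (T - k) ≤ T := (min_le_right _ _).trans (Nat.sub_le _ _)
  have h1' : ((∑ s ∈ Finset.univ.filter (fun s : Fin T => k ≤ (s : ℕ)),
      if ceThreshold b (T - k) ≤ quantileSample F (θ s ω) (U s ω) then 1 else 0 : ℕ) : ℝ) ≤ T :=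
    Nat.cast_le.2 h1
  have h2' : ((min b (T - k) : ℕ) : ℝ) ≤ T := Nat.cast_le.2 h2
  unfold hiringMismatch
  rw [abs_le]
  constructor <;> linarith [Nat.cast_nonneg (α := ℝ) (min b (T - k)),
    Nat.cast_nonneg (α := ℝ) (∑ s ∈ Finset.univ.filter (fun s : Fin T => k ≤ (s : ℕ)),
      if ceThreshold b (T - k) ≤ quantileSample F (θ s ω) (U s ω) then 1 else 0)]

omit [MeasurableSpace Ω] in
theorem measurable_future_hiringMismatch (k b : ℕ) : Measurable[future θ U k]
    (hiringMismatch (cdf (discreteLaw a f)) k b θ U) := by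
  classical
  have h1 : Measurable[future θ U k] fun ω =>
      ∑ s ∈ Finset.univ.filter (fun s : Fin T => k ≤ (s : ℕ)),
      if ceThreshold b (T - k) ≤ quantileSample (cdf (discreteLaw a f)) (θ s ω) (U s ω)
        then 1 else 0 := by
    refine Finset.measurable_sum _ fun s hs' => ?_
    refine Measurable.ite (measurableSet_le measurable_const
      (measurable_future_sampled ha ha01 hf hs ?_)) measurable_const measurable_const
    simpa using hs'
  exact (measurable_of_countable
    fun n : ℕ => |(n : ℝ) - (min b (T - k) : ℕ)|).comp h1

/-- The expected mismatch when the budget depends on the first `k` periods only. -/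
theorem integral_hiringMismatch_le [IsProbabilityMeasure P]
    (h : IsSampling P (discreteLaw a f) θ U) {k : ℕ} (hk : k ≤ T) {b : Ω → ℕ}
    (hb : Measurable[past θ U k] b) (hbB : ∀ ω, b ω ≤ B) :
    Integrable (fun ω => hiringMismatch (cdf (discreteLaw a f)) k (b ω) θ U ω) P ∧
    ∫ ω, hiringMismatch (cdf (discreteLaw a f)) k (b ω) θ U ω ∂P ≤
      Real.sqrt (T - k : ℕ) / 2 := by
  classical
  set D : ℕ → Ω → ℝ := fun c => hiringMismatch (cdf (discreteLaw a f)) k c θ U with hD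
  set χ : ℕ → Ω → ℝ := fun c ω => if b ω = c then 1 else 0 with hχ
  have hDf : ∀ c, Measurable[future θ U k] (D c) := fun c =>
    measurable_future_hiringMismatch ha ha01 hf hs k c
  have hχp : ∀ c, Measurable[past θ U k] (χ c) := fun c =>
    (measurable_of_countable fun n : ℕ => if n = c then (1 : ℝ) else 0).comp hb
  have hDm : ∀ c, Measurable (D c) := fun c =>
    (hDf c).mono (iSup₂_le fun i _ => (h.measurable_elim i).comap_le) le_rfl
  have hχm : ∀ c, Measurable (χ c) := fun c => (hχp c).mono (h.past_le k) le_rfl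
  have hind : ∀ c, IndepFun (χ c) (D c) P := fun c =>
    indep_of_indep_of_le_left (indep_of_indep_of_le_right (h.indep_past_future k)
      (hDf c).comap_le) (hχp c).comap_le
  have hDint : ∀ c, Integrable (D c) P := fun c =>
    Integrable.of_mem_Icc 0 T (hDm c).aemeasurable
      (Filter.Eventually.of_forall fun ω => hiringMismatch_mem_Icc _ _ _ ω)
  have hχint : ∀ c, Integrable (χ c) P := fun c =>
    Integrable.of_mem_Icc 0 1 (hχm c).aemeasurable
      (Filter.Eventually.of_forall fun ω => by simp only [hχ]; split_ifs <;> simp)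
  -- Conditioning on the budget by splitting over its finitely many values: each indicator belongs
  -- to the past and each mismatch with frozen budget to the future, so the expectations factor.
  have hdecomp : (fun ω => hiringMismatch (cdf (discreteLaw a f)) k (b ω) θ U ω) =
      fun ω => ∑ c ∈ Finset.range (B + 1), χ c ω * D c ω := by
    funext ω
    simp only [hχ, ite_mul, one_mul, zero_mul]
    rw [Finset.sum_ite_eq, if_pos (Finset.mem_range.2 (Nat.lt_succ_of_le (hbB ω)))]
  have hprod : ∀ c, Integrable (fun ω => χ c ω * D c ω) P := fun c =>
    (hind c).integrable_mul (hχint c) (hDint c)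
  have hone : ∑ c ∈ Finset.range (B + 1), ∫ ω, χ c ω ∂P = 1 := by
    rw [← integral_finsetSum _ fun c _ => hχint c]
    have : (fun ω => ∑ c ∈ Finset.range (B + 1), χ c ω) = fun _ => 1 := by
      funext ω
      simp only [hχ]
      rw [Finset.sum_ite_eq, if_pos (Finset.mem_range.2 (Nat.lt_succ_of_le (hbB ω)))]
    rw [this]
    simp
  rw [hdecomp]
  refine ⟨integrable_finsetSum _ fun c _ => hprod c, ?_⟩
  rw [integral_finsetSum _ fun c _ => hprod c]
  calc ∑ c ∈ Finset.range (B + 1), ∫ ω, χ c ω * D c ω ∂P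
      = ∑ c ∈ Finset.range (B + 1), (∫ ω, χ c ω ∂P) * ∫ ω, D c ω ∂P :=
        Finset.sum_congr rfl fun c _ => (hind c).integral_fun_mul_eq_mul_integral
          (hχm c).aestronglyMeasurable (hDm c).aestronglyMeasurable
    _ ≤ ∑ c ∈ Finset.range (B + 1), (∫ ω, χ c ω ∂P) * (Real.sqrt (T - k : ℕ) / 2) := by
        refine Finset.sum_le_sum fun c _ => mul_le_mul_of_nonneg_left
          (integral_abs_count_sub_le ha ha01 hf hs h k c hk) (integral_nonneg fun ω => ?_)
        simp only [hχ, Pi.zero_apply]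
        split_ifs <;> simp
    _ = _ := by rw [← Finset.sum_mul, hone, one_mul]

end Policy


/-! ### Numerical bounds for the two phases -/

theorem sum_inv_sq_remaining_le (T : ℕ) : ∑ t : Fin T, (((T - t : ℕ) : ℝ) ^ 2)⁻¹ ≤ 2 := by
  have hinj : Set.InjOn (fun t : Fin T => T - (t : ℕ)) (Finset.univ : Finset (Fin T)) := by
    intro s _ t _ hst
    have : T - (s : ℕ) = T - (t : ℕ) := hst
    ext
    omega
  rw [← Finset.sum_image (f := fun i : ℕ => ((i : ℝ) ^ 2)⁻¹) hinj]
  calc _ ≤ ∑ i ∈ Finset.Ioo 0 (T + 1), ((i : ℝ) ^ 2)⁻¹ := by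
        apply Finset.sum_le_sum_of_subset_of_nonneg
        · intro i hi
          obtain ⟨t, -, rfl⟩ := Finset.mem_image.1 hi
          rw [Finset.mem_Ioo]
          omega
        · intros
          positivity
    _ ≤ 2 / ((0 : ℕ) + 1) := sum_Ioo_inv_sq_le 0 (T + 1)
    _ = 2 := by norm_num

/-- The constant is `2 * 128 + 4 / 2`. Having `m - 1` rather than `m` matters: for a single atom `ε₀
= 1` and the right-hand side is 0. For `m ≥ 2` one has `ε₀ ≤ 1 / 2`, so the square root of the
logarithm is at least `1 / 2` and `m ≤ 1 / ε₀` suffices. -/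
theorem gap_add_sqrt_le {m : ℕ} {f : Fin m → ℝ} {ε₀ : ℝ} (hf : ∀ i, 0 < f i) (hs : ∑ i, f i = 1)
    (hε : IsLeast (Set.range f) ε₀) {n : ℕ} (hn : n ≤ ⌊16 * Real.log (1 / ε₀) / ε₀ ^ 2⌋₊) :
    (m - 1 : ℕ) * 128 + Real.sqrt n / 2 ≤ 258 * (Real.sqrt (Real.log (1 / ε₀)) / ε₀) := by
  have hmε := card_mul_minMass_le_one hs hε
  obtain ⟨i, hi⟩ := hε.1
  have h0 : 0 < ε₀ := hi ▸ hf i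
  have h1 : ε₀ ≤ 1 := by
    have : (1 : ℝ) ≤ m := by exact_mod_cast i.pos
    nlinarith
  set L := Real.log (1 / ε₀) with hLdef
  have hL0 : 0 ≤ L := Real.log_nonneg (by rwa [le_div_iff₀ h0, one_mul])
  have hsq : Real.sqrt n ≤ 4 * (Real.sqrt L / ε₀) := by
    have e : 4 * (Real.sqrt L / ε₀) = Real.sqrt (16 * L / ε₀ ^ 2) := by
      rw [Real.sqrt_div (by positivity), Real.sqrt_sq h0.le, Real.sqrt_mul (by norm_num),
        show (16 : ℝ) = 4 ^ 2 by norm_num, Real.sqrt_sq (by norm_num)]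
      ring
    rw [e]
    exact Real.sqrt_le_sqrt ((Nat.le_floor_iff (by positivity)).1 hn)
  have hmain : ((m - 1 : ℕ) : ℝ) ≤ 2 * (Real.sqrt L / ε₀) := by
    rcases Nat.lt_or_ge 1 m with hm | hm
    · have hm' : (2 : ℝ) ≤ m := by exact_mod_cast hm
      have hε2 : ε₀ ≤ 1 / 2 := by nlinarith
      have hL : Real.log 2 ≤ L :=
        Real.log_le_log (by norm_num) (by rw [le_div_iff₀ h0]; linarith)
      have hL2 : 1 / 2 ≤ Real.sqrt L :=
        Real.le_sqrt_of_sq_le (by linarith [Real.log_two_gt_d9])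
      have h3 : ((m - 1 : ℕ) : ℝ) ≤ m := by exact_mod_cast Nat.sub_le _ _
      rw [← mul_div_assoc, le_div_iff₀ h0]
      nlinarith
    · rw [Nat.sub_eq_zero_of_le hm, Nat.cast_zero]
      positivity
  linarith

/-! ### Integration of the pathwise bound -/

section Regret

variable {Ω : Type*} [MeasurableSpace Ω] {P : Measure Ω} {m : ℕ} {a f : Fin m → ℝ} {T : ℕ}
  {θ U : Fin T → Ω → ℝ}

theorem ae_ability_mem_Icc (ha01 : ∀ i, a i ∈ Set.Icc (0 : ℝ) 1)
    (h : IsSampling P (discreteLaw a f) θ U) : ∀ᵐ ω ∂P, ∀ t, θ t ω ∈ Set.Icc (0 : ℝ) 1 := by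
  filter_upwards [h.ae_mem_range] with ω hω t
  obtain ⟨i, hi⟩ := hω t
  exact hi ▸ ha01 i

theorem sum_selected_mem_Icc {x : Fin T → ℝ} (hx : ∀ t, x t ∈ Set.Icc (0 : ℝ) 1)
    (μ : Fin T → Bool) : ∑ t, (if μ t = true then x t else 0) ∈ Set.Icc (0 : ℝ) T := by
  constructor
  · exact Finset.sum_nonneg fun t _ => by split_ifs; exacts [(hx t).1, le_rfl]
  · calc ∑ t, (if μ t = true then x t else 0) ≤ ∑ _t : Fin T, (1 : ℝ) :=
          Finset.sum_le_sum fun t _ => by split_ifs; exacts [(hx t).2, zero_le_one]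
      _ = T := by simp

theorem measurableSet_gapDeviation (h : IsSampling P (discreteLaw a f) θ U) (ε₀ : ℝ) (t : Fin T) :
    MeasurableSet {ω | GapDeviation a f ε₀ (fun s => θ s ω) t} := by
  classical
  have : ∀ i : Fin m, Measurable fun ω =>
      (Finset.univ.filter fun s : Fin T => (t : ℕ) + 1 ≤ s ∧ a i < θ s ω).card := by
    intro i
    simp only [Finset.card_filter]
    refine Finset.measurable_sum _ fun s _ => ?_
    refine Measurable.ite ?_ measurable_const measurable_const
    exact (MeasurableSet.const _).inter
      (measurableSet_lt measurable_const (h.measurable_ability s))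
  have hdev : ∀ i : Fin m, Measurable fun ω =>
      |((Finset.univ.filter fun s : Fin T => (t : ℕ) + 1 ≤ s ∧ a i < θ s ω).card : ℝ) -
        (((T - t : ℕ) : ℝ) - 1) * (1 - cumMass f (i + 1))| := fun i =>
    (measurable_of_countable fun n : ℕ =>
      |(n : ℝ) - (((T - t : ℕ) : ℝ) - 1) * (1 - cumMass f (i + 1))|).comp (this i)
  simp only [GapDeviation, Set.ofPred_exists]
  exact MeasurableSet.iUnion fun i =>
    (MeasurableSet.const _).inter (measurableSet_le measurable_const (hdev i))

variable [IsProbabilityMeasure P]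

/-- Makes the set of regrets bounded below, without which the real infimum would carry no
information. The norm bound on the integral requires no measurability of `μ`. -/
theorem onlineValue_le (ha01 : ∀ i, a i ∈ Set.Icc (0 : ℝ) 1)
    (h : IsSampling P (discreteLaw a f) θ U) (μ : Fin T → Ω → Bool) :
    onlineValue P θ μ ≤ T := by
  have := norm_integral_le_of_norm_le_const (μ := P) (C := (T : ℝ))
    (f := fun ω => ∑ t, (if μ t ω = true then θ t ω else 0)) (by
      filter_upwards [ae_ability_mem_Icc ha01 h] with ω hω
      have := sum_selected_mem_Icc hω fun t => μ t ω
      rw [Real.norm_of_nonneg this.1]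
      exact this.2)
  rw [probReal_univ, mul_one] at this
  exact (le_abs_self _).trans this

theorem optimalRegret_le (ha01 : ∀ i, a i ∈ Set.Icc (0 : ℝ) 1)
    (h : IsSampling P (discreteLaw a f) θ U) {B : ℕ} {μ : Fin T → Ω → Bool}
    (hμ : μ ∈ feasiblePolicies P θ U B) : optimalRegret P θ U B ≤ regret P θ B μ := by
  refine ciInf_le (f := fun μ : feasiblePolicies P θ U B => regret P θ B μ.1)
    ⟨offlineValue P θ B - T, ?_⟩ ⟨μ, hμ⟩
  rintro _ ⟨ν, rfl⟩
  exact sub_le_sub_left (onlineValue_le ha01 h ν.1) _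

theorem integrable_hindsightValue (ha01 : ∀ i, a i ∈ Set.Icc (0 : ℝ) 1)
    (h : IsSampling P (discreteLaw a f) θ U) (B : ℕ) :
    Integrable (fun ω => hindsightValue B fun t => θ t ω) P := by
  have hm : Measurable fun ω => hindsightValue B fun t => θ t ω := by
    have := Finset.measurable_sup' (s := Finset.univ.filter
      fun S : Finset (Fin T) => S.card ≤ B) ⟨∅, by simp⟩
      (f := fun S ω => ∑ t ∈ S, θ t ω)
      fun S _ => Finset.measurable_sum S fun t _ => h.measurable_ability t
    convert this using 1
    ext ω
    exact (Finset.sup'_apply (C := fun _ : Ω => ℝ) ⟨∅, by simp⟩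
      (fun (S : Finset (Fin T)) ω => ∑ t ∈ S, θ t ω) ω).symm
  refine Integrable.of_mem_Icc 0 T hm.aemeasurable ?_
  filter_upwards [ae_ability_mem_Icc ha01 h] with ω hω
  rw [hindsightValue_eq_offlineFrom]
  constructor
  · simpa using le_offlineFrom (v := fun t => θ t ω) (S := ∅) (A := Finset.univ) (b := B)
      (Finset.empty_subset _) (by simp)
  · refine offlineFrom_le fun S _ _ => ?_
    calc ∑ t ∈ S, θ t ω ≤ ∑ _t ∈ S, (1 : ℝ) := Finset.sum_le_sum fun t _ => (hω t).2
      _ ≤ T := by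
        rw [Finset.sum_const, nsmul_eq_mul, mul_one]
        exact_mod_cast (Finset.card_le_univ S).trans (by simp)

theorem regret_cwgPolicy_le (ha : StrictMono a) (ha01 : ∀ i, a i ∈ Set.Icc (0 : ℝ) 1)
    (hf : ∀ i, 0 < f i) (hs : ∑ i, f i = 1) {ε₀ : ℝ} (hε : IsLeast (Set.range f) ε₀)
    {p : ℕ → ℕ → ℝ} (hp : IsCwGThreshold (gapQuantiles (cdf (discreteLaw a f)) a) p)
    (h : IsSampling P (discreteLaw a f) θ U) (B : ℕ) :
    regret P θ B (cwgPolicy (cdf (discreteLaw a f)) ε₀ p B θ U) ≤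
      (m - 1 : ℕ) * 128 + Real.sqrt (T - phaseOneLength ε₀ T : ℕ) / 2 := by
  classical
  set k := phaseOneLength ε₀ T with hk
  have hkT : k ≤ T := Nat.sub_le _ _
  set F : ℝ → ℝ := ⇑(cdf (discreteLaw a f)) with hF
  set X : Ω → Fin T → ℝ := fun ω s => quantileSample F (θ s ω) (U s ω) with hX
  set b : Ω → ℕ := fun ω => budgetAfter (fun s c => p (T - s) c) B (X ω) k with hb
  have hbm : Measurable[past θ U k] b := measurable_budgetAfter past_mono
    (measurable_past_sampled ha ha01 hf hs) B fun _ _ _ => measurable_const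
  obtain ⟨hMint, hMle⟩ := integral_hiringMismatch_le ha ha01 hf hs h hkT hbm
    fun ω => budgetAfter_le k
  have hpoint : ∀ᵐ ω ∂P, (hindsightValue B fun t => θ t ω) -
      ∑ t, (if cwgPolicy F ε₀ p B θ U t ω = true then θ t ω else 0) ≤
      ∑ t ∈ Finset.univ.filter (fun t : Fin T => (t : ℕ) < k),
        Set.indicator {ω | GapDeviation a f ε₀ (fun s => θ s ω) t} 1 ω +
      hiringMismatch F k (b ω) θ U ω := by
    filter_upwards [h.ae_mem_range, h.ae_aux_mem] with ω hω hU
    choose j hj using hω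
    -- Almost surely the auxiliary variables avoid 0 and 1, so the sampled quantiles are never gap
    -- quantiles.
    have hXj : ∀ t, X ω t ∈ Set.Ioo (cumMass f (j t)) (cumMass f (j t + 1)) := by
      intro t
      simp only [hX]
      rw [← hj t, hF, quantileSample_eq ha ha01 hf hs, cumMass_succ]
      have := hf (j t)
      have h1 := (hU t).1
      have h2 := (hU t).2
      constructor <;> nlinarith
    have key := hindsightValue_le_cwg ha hf hs hε hp hXj ha01 B
    simp only [hj] at key
    simp only [Set.indicator_apply, Set.mem_ofPred_eq, Pi.one_apply, hiringMismatch, cwgPolicy]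
    rw [add_assoc] at key
    exact sub_le_iff_le_add'.2 key
  have hIint : ∀ t : Fin T, Integrable
      (Set.indicator {ω | GapDeviation a f ε₀ (fun s => θ s ω) t} (1 : Ω → ℝ)) P := fun t =>
    (integrable_const (1 : ℝ)).indicator (measurableSet_gapDeviation h ε₀ t)
  have honline : Integrable
      (fun ω => ∑ t, (if cwgPolicy F ε₀ p B θ U t ω = true then θ t ω else 0)) P := by
    refine Integrable.of_mem_Icc 0 T (Measurable.aemeasurable ?_) ?_
    · refine Finset.measurable_sum _ fun t _ => ?_
      refine Measurable.ite ?_ (h.measurable_ability t) measurable_const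
      have hle : history θ U t ≤ ‹MeasurableSpace Ω› := iSup₂_le fun s _ =>
        sup_le (h.measurable_ability s).comap_le (h.measurable_aux s).comap_le
      exact (measurable_cwgPolicy ha ha01 hf hs t).mono hle le_rfl (measurableSet_singleton true)
    · filter_upwards [ae_ability_mem_Icc ha01 h] with ω hω
      exact sum_selected_mem_Icc hω _
  have hoff := integrable_hindsightValue ha01 h B
  rw [regret, offlineValue, onlineValue, ← integral_sub hoff honline]
  calc _ ≤ ∫ ω, (∑ t ∈ Finset.univ.filter (fun t : Fin T => (t : ℕ) < k),
          Set.indicator {ω | GapDeviation a f ε₀ (fun s => θ s ω) t} 1 ω +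
          hiringMismatch F k (b ω) θ U ω) ∂P :=
        integral_mono_ae (hoff.sub honline)
          ((integrable_finsetSum _ fun t _ => hIint t).add hMint) hpoint
    _ = ∑ t ∈ Finset.univ.filter (fun t : Fin T => (t : ℕ) < k),
          P.real {ω | GapDeviation a f ε₀ (fun s => θ s ω) t} +
          ∫ ω, hiringMismatch F k (b ω) θ U ω ∂P := by
        rw [integral_add (integrable_finsetSum _ fun t _ => hIint t) hMint,
          integral_finsetSum _ fun t _ => hIint t]
        congr 1
        exact Finset.sum_congr rfl fun t _ =>
          integral_indicator_one (measurableSet_gapDeviation h ε₀ t)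
    _ ≤ _ := by
        refine add_le_add ?_ hMle
        calc _ ≤ ∑ t ∈ Finset.univ.filter (fun t : Fin T => (t : ℕ) < k),
              (m - 1 : ℕ) * (64 * (((T - t : ℕ) : ℝ) ^ 2)⁻¹) :=
              Finset.sum_le_sum fun t ht => measureReal_gapDeviation_le ha hf hs h hε t
                (lt_of_phaseOne (Finset.mem_filter.1 ht).2)
          _ ≤ ∑ t : Fin T, (m - 1 : ℕ) * (64 * (((T - t : ℕ) : ℝ) ^ 2)⁻¹) :=
              Finset.sum_le_sum_of_subset_of_nonneg (Finset.filter_subset _ _)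
                fun _ _ _ => by positivity
          _ = (m - 1 : ℕ) * (64 * ∑ t : Fin T, (((T - t : ℕ) : ℝ) ^ 2)⁻¹) := by
              rw [Finset.mul_sum, Finset.mul_sum]
          _ ≤ (m - 1 : ℕ) * 128 := by
              gcongr
              linarith [sum_inv_sq_remaining_le T]

end Regret

end MultiSecretary

end

theorem corollary1 :
    ∃ C : ℝ, ∀ (m : ℕ) (a f : Fin m → ℝ),
      StrictMono a → (∀ i, a i ∈ Set.Icc (0 : ℝ) 1) → (∀ i, 0 < f i) → ∑ i, f i = 1 →
      ∀ ε₀ : ℝ, IsLeast (Set.range f) ε₀ →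
      ∀ p : ℕ → ℕ → ℝ,
        MultiSecretary.IsCwGThreshold
          (MultiSecretary.gapQuantiles (cdf (MultiSecretary.discreteLaw a f)) a) p →
      ∀ T B : ℕ, 1 ≤ B → B ≤ T →
      ∀ (Ω : Type*) [MeasurableSpace Ω] (P : Measure Ω) [IsProbabilityMeasure P]
        (θ U : Fin T → Ω → ℝ),
        MultiSecretary.IsSampling P (MultiSecretary.discreteLaw a f) θ U →
        MultiSecretary.cwgPolicy (cdf (MultiSecretary.discreteLaw a f)) ε₀ p B θ U ∈
            MultiSecretary.feasiblePolicies P θ U B ∧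
        MultiSecretary.optimalRegret P θ U B ≤
          MultiSecretary.regret P θ B
            (MultiSecretary.cwgPolicy (cdf (MultiSecretary.discreteLaw a f)) ε₀ p B θ U) ∧
        MultiSecretary.regret P θ B
            (MultiSecretary.cwgPolicy (cdf (MultiSecretary.discreteLaw a f)) ε₀ p B θ U) ≤
          C * (Real.sqrt (Real.log (1 / ε₀)) / ε₀) := by
  refine ⟨258, fun m a f ha ha01 hf hs ε₀ hε p hp T B _ _ Ω _ P _ θ U h => ?_⟩
  have hfeas := MultiSecretary.cwgPolicy_mem_feasiblePolicies (P := P) (θ := θ) (U := U)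
    (ε₀ := ε₀) (p := p) (B := B) ha ha01 hf hs
  refine ⟨hfeas, MultiSecretary.optimalRegret_le ha01 h hfeas, ?_⟩
  refine (MultiSecretary.regret_cwgPolicy_le ha ha01 hf hs hε hp h B).trans ?_
  refine MultiSecretary.gap_add_sqrt_le hf hs hε ?_
  rw [MultiSecretary.phaseOneLength]
  omega
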